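/- Let $d$ be a natural number, let $\mathcal{P}$ be a countable index set, let $C_p$ be an invertible real $d\times d$ matrix for each $p\in\mathcal{P}$, and write $C_p^{*}$ for its transpose and $C_p'=(C_p^{*})^{-1}$. Set $$\Lambda=\bigcup_{p\in\mathcal{P}}C_p'\mathbb{Z}^d,\qquad \mathcal{P}_\alpha=\{p\in\mathcal{P}: C_p^{*}\alpha\in\mathbb{Z}^d\}\quad(\alpha\in\Lambda).$$ Let $\hat f(\xi)=\int f(x)e^{-2\pi i x\cdot\xi}\,dx$ denote the Fourier transform, extended to $L^2(\mathbb{R}^d)$, let $T_a f(x)=f(x-a)$, and let $g_p,h_p\in L^2(\mathbb{R}^d)$ for $p\in\mathcal{P}$. A family $\{x_j\}$ in a Hilbert space $H$ is Bessel if there is $B<\infty$ with $\sum_j|\langle v,x_j\rangle|^2\le B\|v\|^2$ for all $v\in H$. If $M\subset H$ is a closed subspace, a Bessel family $\{y_j\}$ is an $M$-subspace dual to a Bessel family $\{x_j\}$ if $v=\sum_j\langle v,x_j\rangle y_j$ for all $v\in M$. The system $\{T_{C_pk}g_p: p\in\mathcal{P},k\in\mathbb{Z}^d\}$ satisfies the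 local integrability condition if $$\sum_{p\in\mathcal{P}}\sum_{k\in\mathbb{Z}^d}\int_{\operatorname{supp}\hat f}|\hat f(\xi+C_p'k)|^2\,|\det C_p|^{-1}\,|\hat g_p(\xi)|^2\,d\xi<\infty$$ for every $f\in L^2(\mathbb{R}^d)$ such that $\hat f\in L^\infty(\mathbb{R}^d)$ and $\operatorname{supp}\hat f$ is compact and bounded away from $0$. For a measurable set $E\subset\mathbb{R}^d$ let $V_E=\{f\in L^2(\mathbb{R}^d):\hat f=0\text{ a.e. outside }E\}$. **Theorem.** Suppose that $\{T_{C_pk}g_p\}$ and $\{T_{C_pk}h_p\}$ are Bessel and satisfy the local integrability condition, and let $E\subset\mathbb{R}^d$ be measurable. Then $\{T_{C_pk}h_p\}$ is a $V_E$-subspace dual to $\{T_{C_pk}g_p\}$ if and only if both of the following hold (with unconditionally convergent sums): 1. $\displaystyle\sum_{p\in\mathcal{P}}|\det C_p|^{-1}\,\overline{\hat h_p(\xi)}\,\hat g_p(\xi)=1$ for a.e. $\xi\in E$; 2. for every $\alpha\in\Lambda\setminus\{0\}$, $\displaystyle\sum_{p\in\mathcal{P}_\alpha}|\det C_p|^{-1}\,\overline{\hat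 h_p(\xi-\alpha)}\,\hat g_p(\xi)=0$ for a.e. $\xi\in E$. -/

import Mathlib

open MeasureTheory Topology
open scoped FourierTransform ENNReal Matrix

noncomputable section

namespace TranslationFrames

/-- Bessel sequences: `∑ⱼ |⟨v, xⱼ⟩|² ≤ B ‖v‖²` for all `v`, for some finite constant `B`. -/
def IsBessel {H J : Type*} [NormedAddCommGroup H] [InnerProductSpace ℂ H] (x : J → H) : Prop :=
  ∃ B : ℝ, ∀ v : H, Summable (fun j => ‖inner ℂ (x j) v‖ ^ 2) ∧
    ∑' j, ‖inner ℂ (x j) v‖ ^ 2 ≤ B * ‖v‖ ^ 2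

/-- `{yⱼ}` is an `M`-subspace dual to `{xⱼ}`: both are Bessel sequences and
`v = ∑ⱼ ⟨v, xⱼ⟩ yⱼ` for all `v ∈ M`. The inner product `⟨v, x⟩`, linear in `v`, is
`inner ℂ x v` in Mathlib. -/
def IsSubspaceDual {H J : Type*} [NormedAddCommGroup H] [InnerProductSpace ℂ H]
    (M : Submodule ℂ H) (x y : J → H) : Prop :=
  IsBessel x ∧ IsBessel y ∧ ∀ v ∈ M, HasSum (fun j => inner ℂ (x j) v • y j) v

/-- The Hilbert space `L²(ℝᵈ)`. -/
abbrev L2 (d : ℕ) : Type :=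
  Lp ℂ 2 (volume : Measure (EuclideanSpace ℝ (Fin d)))

/-- The translation operator `(T_a f)(x) = f(x - a)` on `L²(ℝᵈ)`. -/
def translateL2 {d : ℕ} (a : EuclideanSpace ℝ (Fin d)) (f : L2 d) : L2 d :=
  Lp.compMeasurePreserving (fun x => x - a) (measurePreserving_sub_right volume a) f

/-- The vector `A k`, for a real matrix `A` and `k ∈ ℤᵈ`. -/
def latticePoint {d : ℕ} (A : Matrix (Fin d) (Fin d) ℝ) (k : Fin d → ℤ) :
    EuclideanSpace ℝ (Fin d) :=
  WithLp.toLp 2 (A *ᵥ fun i => (k i : ℝ))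

/-- `C'`, the inverse of the transpose of `C`. -/
def dualMatrix {d : ℕ} (C : Matrix (Fin d) (Fin d) ℝ) : Matrix (Fin d) (Fin d) ℝ :=
  (Cᵀ)⁻¹

/-- The system `{T_{C_p k} g_p : p ∈ P, k ∈ ℤᵈ}`, indexed by the pairs `(p, k)`. -/
def translationSystem {d : ℕ} {P : Type*} (C : P → Matrix (Fin d) (Fin d) ℝ) (g : P → L2 d) :
    P × (Fin d → ℤ) → L2 d :=
  fun j => translateL2 (latticePoint (C j.1) j.2) (g j.1)

/-- `Λ = ⋃ₚ C_p' ℤᵈ`. -/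
def dualLatticeUnion {d : ℕ} {P : Type*} (C : P → Matrix (Fin d) (Fin d) ℝ) :
    Set (EuclideanSpace ℝ (Fin d)) :=
  ⋃ p, Set.range (latticePoint (dualMatrix (C p)))

/-- `P_α = {p ∈ P : C_p^* α ∈ ℤᵈ}`. -/
def indexSet {d : ℕ} {P : Type*} (C : P → Matrix (Fin d) (Fin d) ℝ)
    (α : EuclideanSpace ℝ (Fin d)) : Set P :=
  {p | ∃ k : Fin d → ℤ, (C p)ᵀ *ᵥ α.ofLp = fun i => (k i : ℝ)}

/-- The (closed) support of a function on `ℝᵈ` defined up to null sets: the complement of the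
largest open set on which the function vanishes almost everywhere. -/
def essSupport {d : ℕ} (u : EuclideanSpace ℝ (Fin d) → ℂ) : Set (EuclideanSpace ℝ (Fin d)) :=
  {ξ | ∀ U ∈ 𝓝 ξ, ¬ (∀ᵐ η, η ∈ U → u η = 0)}

/-- The class `𝒟` of all `f ∈ L²(ℝᵈ)` whose Fourier transform is essentially bounded, with
compact support bounded away from `0`. -/
def testClass (d : ℕ) : Set (L2 d) :=
  {f | MemLp (𝓕 f : L2 d) ∞ volume ∧ IsCompact (essSupport (𝓕 f : L2 d)) ∧
    (0 : EuclideanSpace ℝ (Fin d)) ∉ essSupport (𝓕 f : L2 d)}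

/-- The local integrability condition for `{T_{C_p k} g_p}`. -/
def LocallyIntegrableSystem {d : ℕ} {P : Type*} (C : P → Matrix (Fin d) (Fin d) ℝ)
    (g : P → L2 d) : Prop :=
  ∀ f ∈ testClass d,
    ∑' p, ∑' k : Fin d → ℤ, ∫⁻ ξ in essSupport (𝓕 f : L2 d),
      ‖(𝓕 f : L2 d) (ξ + latticePoint (dualMatrix (C p)) k)‖ₑ ^ 2 *
        ENNReal.ofReal (|(C p).det|⁻¹) * ‖(𝓕 (g p) : L2 d) ξ‖ₑ ^ 2 < ∞

/-- `V_E`, the space of all `f ∈ L²(ℝᵈ)` whose Fourier transform vanishes almost everywhere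
outside `E`. -/
def bandSpace {d : ℕ} (E : Set (EuclideanSpace ℝ (Fin d))) : Submodule ℂ (L2 d) where
  carrier := {f | ∀ᵐ ξ, ξ ∉ E → (𝓕 f : L2 d) ξ = 0}
  zero_mem' := by
    have h0 : (𝓕 (0 : L2 d) : L2 d) = 0 := (Lp.fourierTransformₗᵢ _ ℂ).map_zero
    simp only [Set.mem_ofPred_eq, h0]
    filter_upwards [Lp.coeFn_zero ℂ 2 (volume : Measure (EuclideanSpace ℝ (Fin d)))] with ξ h _
    exact h
  add_mem' := by
    intro a b ha hb
    simp only [Set.mem_ofPred_eq, FourierTransform.fourier_add] at *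
    filter_upwards [ha, hb, Lp.coeFn_add (𝓕 a : L2 d) (𝓕 b)] with ξ h1 h2 h3 hξ
    rw [h3, Pi.add_apply, h1 hξ, h2 hξ, add_zero]
  smul_mem' := by
    intro c a ha
    simp only [Set.mem_ofPred_eq, FourierTransform.fourier_smul] at *
    filter_upwards [ha, Lp.coeFn_smul c (𝓕 a : L2 d)] with ξ h1 h3 hξ
    rw [h3, Pi.smul_apply, h1 hξ, smul_zero]

end TranslationFrames

end

/-! The Bessel bounds make `S f = ∑ ⟨f, T_{C_p k} g_p⟩ T_{C_p k} h_p` a bounded operator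
(`exists_mixedFrameOperator`), and duality says exactly that `S` is the identity on `V_E`.
Everything is read off the numbers `⟨S f, u⟩` for `f`, `u` whose transforms `φ`, `ψ` are bounded and
live on a spherical shell.

For fixed `p`, the sum over `k` is a Parseval sum for the lattice `C_p ℤᵈ`, hence a sum over the
dual lattice (`hasSum_parseval_lattice`). Local integrability makes the resulting double series
absolutely convergent (`tsum_lintegral_pairTerm_lt_top`), so it may be regrouped by frequency `α ∈
Λ`: `⟨S f, u⟩ = ∑_α ∫ φ(ξ) conj ψ(ξ - α) conj D_α(ξ) dξ`, where `D_α` (`dualSum`) is the series of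
the duality condition at `α`.

If `D_0 = 1` and `D_α = 0` for `α ≠ 0` on `E`, only `⟨f, u⟩` survives, and weak approximation gives
`S f = f` on all of `V_E`. Conversely, multiplying `φ` and `ψ` by the same character `exp (2πi a·ξ)`
keeps `f` in `V_E` and preserves `⟨f, u⟩`, while the `α`-th term acquires the factor `exp (2πi
a·α)`. If `S` is the identity on `V_E`, an absolutely convergent trigonometric series in `a` is thus
constant, so its coefficients are determined (`tsum_frequency_eq`). Letting `φ` run over indicators
gives the values of `D_α` almost everywhere on `E`. -/

namespace TranslationFrames

/-! ### Parseval's identity on the unit cube -/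

/-- The half-open unit cube, a fundamental domain of `ℤᵈ` in `ℝᵈ`. -/
def unitCube (d : ℕ) : Set (Fin d → ℝ) := {x | ∀ i, x i ∈ Set.Ioc (0 : ℝ) (0 + 1)}

lemma measurableSet_unitCube (d : ℕ) : MeasurableSet (unitCube d) := by
  have : unitCube d = Set.univ.pi fun _ => Set.Ioc (0 : ℝ) (0 + 1) := by ext; simp [unitCube]
  rw [this]
  exact MeasurableSet.univ_pi fun _ => measurableSet_Ioc

/-- The character `x ↦ exp (2πi k·x)` of `ℝᵈ`. -/
noncomputable def charInt {d : ℕ} (k : Fin d → ℤ) (x : Fin d → ℝ) : ℂ :=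
  Complex.exp (2 * Real.pi * Complex.I * ∑ i, (k i : ℂ) * (x i : ℂ))

noncomputable section Torus

-- Multivariate Fourier series are developed for the normalized Haar measure on the circle, so that
-- measure replaces the default one in this section.
attribute [-instance] AddCircle.measureSpace

local instance : MeasureSpace UnitAddCircle := ⟨AddCircle.haarAddCircle⟩

local instance : Measure.IsAddHaarMeasure (volume : Measure UnitAddCircle) :=
  inferInstanceAs (Measure.IsAddHaarMeasure AddCircle.haarAddCircle)

local instance : IsProbabilityMeasure (volume : Measure UnitAddCircle) :=
  inferInstanceAs (IsProbabilityMeasure AddCircle.haarAddCircle)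

lemma charInt_eq_mFourier {d : ℕ} (k : Fin d → ℤ) (x : Fin d → ℝ) :
    charInt k x = UnitAddTorus.mFourier k (fun i => (x i : UnitAddCircle)) := by
  simp only [charInt, UnitAddTorus.mFourier, ContinuousMap.coe_mk, fourier_coe_apply,
    ← Complex.exp_sum, Finset.mul_sum]
  congr 1
  refine Finset.sum_congr rfl fun i _ => ?_
  push_cast
  ring

/-- Parseval on the torus, transported along the measure-preserving identification of the torus with
the cube. -/
lemma hasSum_unitCube_parseval {d : ℕ} {F G : (Fin d → ℝ) → ℂ}
    (hF : MemLp F 2 (volume.restrict (unitCube d))) (hG : MemLp G 2 (volume.restrict (unitCube d))) :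
    HasSum (fun k : Fin d → ℤ => (∫ x in unitCube d, F x * charInt k x) *
      starRingEnd ℂ (∫ x in unitCube d, G x * charInt k x))
      (∫ x in unitCube d, F x * starRingEnd ℂ (G x)) := by
  let r : UnitAddTorus (Fin d) → (Fin d → ℝ) :=
    fun t => (UnitAddTorus.measurableEquivPiIoc (fun _ : Fin d => (0 : ℝ)) t).1
  have hr : MeasurePreserving r volume (volume.restrict (unitCube d)) :=
    (measurePreserving_subtype_coe (measurableSet_unitCube d)).comp
      (UnitAddTorus.measurePreserving_equivPiIoc (fun _ : Fin d => (0 : ℝ)))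
  have hrmk : ∀ t, (fun i => ((r t i : ℝ) : UnitAddCircle)) = t := fun t =>
    (UnitAddTorus.measurableEquivPiIoc (fun _ : Fin d => (0 : ℝ))).symm_apply_apply t
  have hint : ∀ H : (Fin d → ℝ) → ℂ, AEStronglyMeasurable H (volume.restrict (unitCube d)) →
      ∫ x in unitCube d, H x = ∫ t, H (r t) := by
    intro H hH
    rw [← hr.map_eq] at hH ⊢
    exact integral_map hr.measurable.aemeasurable hH
  have hF' := hF.comp_measurePreserving hr
  have hG' := hG.comp_measurePreserving hr
  have hchar : ∀ k : Fin d → ℤ, Continuous (charInt k) := by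
    intro k
    unfold charInt
    fun_prop
  have hcoef : ∀ (H : (Fin d → ℝ) → ℂ) (hH : MemLp H 2 (volume.restrict (unitCube d)))
      (k : Fin d → ℤ), UnitAddTorus.mFourierCoeff (hH.comp_measurePreserving hr).toLp (-k) =
        ∫ x in unitCube d, H x * charInt k x := by
    intro H hH k
    rw [hint (fun x => H x * charInt k x) (hH.1.mul (hchar k).aestronglyMeasurable), UnitAddTorus.mFourierCoeff]
    refine integral_congr_ae ?_
    filter_upwards [(hH.comp_measurePreserving hr).coeFn_toLp] with t ht
    rw [ht, charInt_eq_mFourier, hrmk, neg_neg, smul_eq_mul, mul_comm]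
    rfl
  have key := UnitAddTorus.hasSum_prod_mFourierCoeff hG'.toLp hF'.toLp
  -- `mFourierCoeff` at `n` integrates against the character `-n`, whereas the statement uses
  -- `charInt k`; hence `n = -k`.
  rw [← (Equiv.neg (Fin d → ℤ)).hasSum_iff] at key
  convert key using 1
  · funext k
    simp only [Function.comp, Equiv.neg_apply]
    rw [← hcoef F hF, ← hcoef G hG, mul_comm]
  · rw [hint (fun x => F x * starRingEnd ℂ (G x))
      (hF.1.mul (RCLike.continuous_conj.comp_aestronglyMeasurable hG.1))]
    refine integral_congr_ae ?_
    filter_upwards [hF'.coeFn_toLp, hG'.coeFn_toLp] with t h1 h2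
    rw [h1, h2, mul_comm]
    rfl

end Torus

/-! ### Parseval's identity for the periodizations of two functions -/

/-- An integer vector as a real vector. -/
def intVec {d : ℕ} (k : Fin d → ℤ) : Fin d → ℝ := fun i => (k i : ℝ)

lemma continuous_charInt {d : ℕ} (k : Fin d → ℤ) : Continuous (charInt k) := by
  unfold charInt
  fun_prop

lemma norm_charInt {d : ℕ} (k : Fin d → ℤ) (x : Fin d → ℝ) : ‖charInt k x‖ = 1 := by
  have : (2 * Real.pi * Complex.I * ∑ i, (k i : ℂ) * (x i : ℂ)) =
      ((2 * Real.pi * ∑ i, (k i : ℝ) * x i : ℝ) : ℂ) * Complex.I := by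
    push_cast
    ring
  rw [charInt, this, Complex.norm_exp_ofReal_mul_I]

lemma charInt_add_intVec {d : ℕ} (k m : Fin d → ℤ) (x : Fin d → ℝ) :
    charInt k (x + intVec m) = charInt k x := by
  have : (2 * Real.pi * Complex.I * ∑ i, (k i : ℂ) * ((x + intVec m) i : ℝ)) =
      2 * Real.pi * Complex.I * ∑ i, (k i : ℂ) * (x i : ℂ) +
        ((∑ i, k i * m i : ℤ) : ℂ) * (2 * Real.pi * Complex.I) := by
    simp only [Pi.add_apply, intVec, Complex.ofReal_add, mul_add, Finset.sum_add_distrib]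
    push_cast
    ring
  rw [charInt, this, Complex.exp_add, Complex.exp_int_mul_two_pi_mul_I, mul_one, charInt]

lemma eq_zero_of_mem_unitCube {d : ℕ} {x : Fin d → ℝ} {m : Fin d → ℤ} (hx : x ∈ unitCube d)
    (hm : x + intVec m ∈ unitCube d) : m = 0 := by
  funext i
  have h1 := hx i
  have h2 := hm i
  simp only [Pi.add_apply, intVec, Set.mem_Ioc] at h1 h2
  have h3 : (m i : ℝ) < 1 := by linarith
  have h4 : (-1 : ℝ) < m i := by linarith
  have h5 : m i < 1 := by exact_mod_cast h3
  have h6 : -1 < m i := by exact_mod_cast h4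
  simp only [Pi.zero_apply]
  omega

lemma memLp_comp_add {d : ℕ} {F : (Fin d → ℝ) → ℂ} (hF : MemLp F 2 volume) (a : Fin d → ℝ) :
    MemLp (fun x => F (x + a)) 2 volume :=
  hF.comp_measurePreserving (measurePreserving_add_right volume a)

lemma memLp_comp_sub {d : ℕ} {F : (Fin d → ℝ) → ℂ} (hF : MemLp F 2 volume) (a : Fin d → ℝ) :
    MemLp (fun x => F (x - a)) 2 volume :=
  hF.comp_measurePreserving (measurePreserving_sub_right volume a)

/-- Characters are `ℤᵈ`-periodic, so both functions can be moved to the unit cube without changing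
their coefficients. In the sum over translations only `l = m - n` makes the two cubes overlap, and
that one term is the integral given by Parseval on the cube. -/
lemma hasSum_parseval_translated_cubes {d : ℕ} {A B : (Fin d → ℝ) → ℂ} (hA : MemLp A 2 volume)
    (hB : MemLp B 2 volume) (m n : Fin d → ℤ) (hAm : ∀ x, x - intVec m ∉ unitCube d → A x = 0)
    (hBn : ∀ x, x - intVec n ∉ unitCube d → B x = 0) :
    ∃ v, HasSum (fun k : Fin d → ℤ => (∫ x, A x * charInt k x) *
      starRingEnd ℂ (∫ x, B x * charInt k x)) v ∧
      HasSum (fun l : Fin d → ℤ => ∫ x, A x * starRingEnd ℂ (B (x - intVec l))) v := by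
  have hcoef : ∀ (H : (Fin d → ℝ) → ℂ) (m : Fin d → ℤ)
      (_ : ∀ x, x - intVec m ∉ unitCube d → H x = 0) (k : Fin d → ℤ),
      ∫ x, H x * charInt k x = ∫ x in unitCube d, H (x + intVec m) * charInt k x := by
    intro H m hH k
    rw [← integral_add_right_eq_self _ (intVec m), setIntegral_eq_integral_of_forall_compl_eq_zero]
    · simp_rw [charInt_add_intVec]
    · intro x hx
      rw [hH _ (by rwa [add_sub_cancel_right]), zero_mul]
  refine ⟨∫ x in unitCube d, A (x + intVec m) * starRingEnd ℂ (B (x + intVec n)), ?_, ?_⟩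
  · simp_rw [hcoef A m hAm, hcoef B n hBn]
    exact hasSum_unitCube_parseval ((memLp_comp_add hA _).restrict _)
      ((memLp_comp_add hB _).restrict _)
  · convert hasSum_single (m - n) ?_ using 1
    · rw [setIntegral_eq_integral_of_forall_compl_eq_zero]
      · refine Eq.trans ?_ (integral_add_right_eq_self _ (intVec m))
        refine integral_congr_ae (ae_of_all _ fun x => ?_)
        have : x + intVec m - intVec (m - n) = x + intVec n := by
          funext i
          simp [intVec]
          ring
        simp only [this]
      · intro x hx
        rw [hAm _ (by rwa [add_sub_cancel_right]), zero_mul]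
    · intro l hl
      refine integral_eq_zero_of_ae (ae_of_all _ fun x => ?_)
      by_cases h1 : x - intVec m ∈ unitCube d
      · by_cases h2 : x - intVec l - intVec n ∈ unitCube d
        · refine absurd ?_ hl
          have h3 : x - intVec l - intVec n = x - intVec m + intVec (m - l - n) := by
            funext i
            simp [intVec]
            ring
          rw [h3] at h2
          have h4 := eq_zero_of_mem_unitCube h1 h2
          rw [← sub_eq_zero, ← neg_eq_zero, ← h4]
          abel
        · simp [hBn _ h2]
      · simp [hAm _ h1]

/-- A finite set of integer translations whose cubes cover a bounded set. -/
lemma exists_finset_cubes (d : ℕ) (R : ℝ) : ∃ s : Finset (Fin d → ℤ), ∀ x : Fin d → ℝ, ‖x‖ ≤ R →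
    ∃ m ∈ s, x - intVec m ∈ unitCube d := by
  classical
  -- The cubes are open on the left and closed on the right, so `x` lies in the cube of index `⌈x i⌉
  -- - 1`, not `⌊x i⌋`.
  refine ⟨Finset.Icc (fun _ => -⌈R⌉ - 1) (fun _ => ⌈R⌉), fun x hx => ⟨fun i => ⌈x i⌉ - 1, ?_, ?_⟩⟩
  · rw [Finset.mem_Icc, Pi.le_def, Pi.le_def]
    have h : ∀ i, |x i| ≤ R := fun i => (norm_le_pi_norm x i).trans hx
    refine ⟨fun i => ?_, fun i => ?_⟩
    · have h1 : -R ≤ x i := (abs_le.1 (h i)).1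
      have h2 : (-⌈R⌉ : ℤ) ≤ ⌈x i⌉ := by
        rw [← @Int.cast_le ℝ]
        push_cast
        linarith [Int.le_ceil R, Int.le_ceil (x i)]
      omega
    · have h1 : ⌈x i⌉ ≤ ⌈R⌉ := Int.ceil_mono (abs_le.1 (h i)).2
      omega
  · intro i
    simp only [Pi.sub_apply, intVec, Set.mem_Ioc]
    push_cast
    constructor <;> linarith [Int.le_ceil (x i), Int.ceil_lt_add_one (x i)]

/-- Integrability of the pieces, which holds because a cube has finite measure, makes Fourier
coefficients additive over the decomposition. -/
lemma exists_sum_cube_pieces {d : ℕ} {F : (Fin d → ℝ) → ℂ} (hF : MemLp F 2 volume) {R : ℝ}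
    (hFR : ∀ x, R < ‖x‖ → F x = 0) :
    ∃ (s : Finset (Fin d → ℤ)) (A : (Fin d → ℤ) → (Fin d → ℝ) → ℂ), (∀ m, MemLp (A m) 2 volume) ∧
      (∀ m, MemLp (A m) 1 volume) ∧
      (∀ m x, x - intVec m ∉ unitCube d → A m x = 0) ∧ ∀ x, F x = ∑ m ∈ s, A m x := by
  classical
  obtain ⟨s, hs⟩ := exists_finset_cubes d R
  have hmeas : ∀ m : Fin d → ℤ, MeasurableSet ((fun x => x - intVec m) ⁻¹' unitCube d) := fun m =>
    (measurable_id.sub_const _) (measurableSet_unitCube d)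
  have h2 : ∀ m : Fin d → ℤ,
      MemLp (((fun x => x - intVec m) ⁻¹' unitCube d).indicator F) 2 volume :=
    fun m => hF.indicator (hmeas m)
  refine ⟨s, fun m => ((fun x => x - intVec m) ⁻¹' unitCube d).indicator F, h2, fun m => ?_,
    fun m x hx => Set.indicator_of_notMem (s := (fun x => x - intVec m) ⁻¹' unitCube d) hx F, fun x => ?_⟩
  · have hfin : volume ((fun x => x - intVec m) ⁻¹' unitCube d) ≠ ∞ := by
      refine ne_of_lt (lt_of_le_of_lt (measure_mono (t := Metric.closedBall (intVec m) 1) ?_)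
        (isCompact_closedBall _ _).measure_lt_top)
      intro x hx
      rw [Metric.mem_closedBall, dist_eq_norm, pi_norm_le_iff_of_nonneg zero_le_one]
      intro i
      have := hx i
      simp only [zero_add, Set.mem_Ioc] at this
      rw [Real.norm_eq_abs, abs_le]
      constructor <;> linarith
    exact (h2 m).mono_exponent_of_measure_support_ne_top
      (fun x hx => Set.indicator_of_notMem hx F) hfin one_le_two
  · by_cases hx : ‖x‖ ≤ R
    · obtain ⟨m, hm, hmx⟩ := hs x hx
      have hval : F x = ((fun x => x - intVec m) ⁻¹' unitCube d).indicator F x :=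
        (Set.indicator_of_mem (s := (fun x => x - intVec m) ⁻¹' unitCube d) hmx F).symm
      refine hval.trans (Finset.sum_eq_single_of_mem
        (f := fun m => ((fun x => x - intVec m) ⁻¹' unitCube d).indicator F x) m hm
        fun n _ hn => ?_).symm
      refine Set.indicator_of_notMem (fun hnx => hn ?_) F
      have h3 : x - intVec n = x - intVec m + intVec (m - n) := by
        funext i
        simp [intVec]
      rw [Set.mem_preimage, h3] at hnx
      exact (sub_eq_zero.1 (eq_zero_of_mem_unitCube hmx hnx)).symm
    · rw [hFR x (not_le.1 hx), Finset.sum_eq_zero]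
      intro m _
      simp [Set.indicator_apply, hFR x (not_le.1 hx)]

/-- Parseval's identity for the `ℤᵈ`-periodizations of two boundedly supported `L²` functions. -/
lemma hasSum_parseval_periodization {d : ℕ} {F G : (Fin d → ℝ) → ℂ} (hF : MemLp F 2 volume)
    (hG : MemLp G 2 volume) {R : ℝ} (hFR : ∀ x, R < ‖x‖ → F x = 0) (hGR : ∀ x, R < ‖x‖ → G x = 0) :
    ∃ v, HasSum (fun k : Fin d → ℤ => (∫ x, F x * charInt k x) *
      starRingEnd ℂ (∫ x, G x * charInt k x)) v ∧
      HasSum (fun l : Fin d → ℤ => ∫ x, F x * starRingEnd ℂ (G (x - intVec l))) v := by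
  obtain ⟨s, A, hA2, hA1, hAs, hFA⟩ := exists_sum_cube_pieces hF hFR
  obtain ⟨t, B, hB2, hB1, hBs, hGB⟩ := exists_sum_cube_pieces hG hGR
  -- Both sides of the identity are sesquilinear and there are finitely many pieces, so the cases of
  -- two single cubes add up without any convergence question.
  have key := fun m n =>
    hasSum_parseval_translated_cubes (hA2 m) (hB2 n) m n (hAs m) (hBs n)
  choose v hv1 hv2 using key
  have hcoef : ∀ (H : (Fin d → ℝ) → ℂ) (u : Finset (Fin d → ℤ)) (D : (Fin d → ℤ) → (Fin d → ℝ) → ℂ)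
      (_ : ∀ m, MemLp (D m) 1 volume) (_ : ∀ x, H x = ∑ m ∈ u, D m x) (k : Fin d → ℤ),
      ∫ x, H x * charInt k x = ∑ m ∈ u, ∫ x, D m x * charInt k x := by
    intro H u D hD hH k
    rw [← integral_finsetSum]
    · simp_rw [hH, Finset.sum_mul]
    · intro m _
      exact (memLp_one_iff_integrable.1 (hD m)).mul_bdd (c := 1)
        (continuous_charInt k).aestronglyMeasurable (ae_of_all _ fun x => (norm_charInt k x).le)
  refine ⟨∑ m ∈ s, ∑ n ∈ t, v m n, ?_, ?_⟩
  · convert hasSum_sum (fun m (_ : m ∈ s) => hasSum_sum (fun n (_ : n ∈ t) => hv1 m n)) using 1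
    funext k
    rw [hcoef F s A hA1 hFA, hcoef G t B hB1 hGB, map_sum, Finset.sum_mul_sum]
  · convert hasSum_sum (fun m (_ : m ∈ s) => hasSum_sum (fun n (_ : n ∈ t) => hv2 m n)) using 1
    funext l
    have hint : ∀ m n, Integrable (fun x => A m x * starRingEnd ℂ (B n (x - intVec l))) volume :=
      fun m n => (hA2 m).integrable_mul (memLp_comp_sub (hB2 n) _).star
    simp_rw [← integral_finsetSum t fun n _ => hint _ n]
    rw [← integral_finsetSum s fun m _ => integrable_finsetSum t fun n _ => hint m n]
    simp_rw [hFA, hGB, map_sum, Finset.sum_mul_sum]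

/-! ### Parseval's identity for a general lattice -/

/-- The character `ξ ↦ exp (2πi a·ξ)` of `ℝᵈ`. -/
noncomputable def planeWave {d : ℕ} (a ξ : EuclideanSpace ℝ (Fin d)) : ℂ :=
  (Real.fourierChar (inner ℝ a ξ) : ℂ)

lemma norm_planeWave {d : ℕ} (a ξ : EuclideanSpace ℝ (Fin d)) : ‖planeWave a ξ‖ = 1 :=
  Circle.norm_coe _

lemma continuous_planeWave {d : ℕ} (a : EuclideanSpace ℝ (Fin d)) : Continuous (planeWave a) := by
  unfold planeWave
  fun_prop

/-- The linear change of variables `ℝᵈ → ℝᵈ` given by `A`. -/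
noncomputable def matrixMap {d : ℕ} (A : Matrix (Fin d) (Fin d) ℝ) (η : Fin d → ℝ) :
    EuclideanSpace ℝ (Fin d) := WithLp.toLp 2 (A *ᵥ η)

lemma matrixMap_sub_intVec {d : ℕ} (A : Matrix (Fin d) (Fin d) ℝ) (η : Fin d → ℝ)
    (k : Fin d → ℤ) : matrixMap A (η - intVec k) = matrixMap A η - latticePoint A k := by
  simp only [matrixMap, Matrix.mulVec_sub, latticePoint, WithLp.toLp_sub]
  rfl

lemma continuous_matrixMap {d : ℕ} (A : Matrix (Fin d) (Fin d) ℝ) : Continuous (matrixMap A) := by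
  unfold matrixMap
  fun_prop

lemma det_dualMatrix {d : ℕ} (C : Matrix (Fin d) (Fin d) ℝ) : (dualMatrix C).det = C.det⁻¹ := by
  rw [dualMatrix, Matrix.det_nonsing_inv, Matrix.det_transpose, Ring.inverse_eq_inv']

lemma isUnit_det_dualMatrix {d : ℕ} {C : Matrix (Fin d) (Fin d) ℝ} (hC : IsUnit C.det) :
    IsUnit (dualMatrix C).det := by
  rw [det_dualMatrix]
  exact hC.inv

/-- Since `C k · C' η = k · η`, the substitution `ξ = C' η` reduces a general lattice to `ℤᵈ`. -/
lemma planeWave_matrixMap {d : ℕ} {C : Matrix (Fin d) (Fin d) ℝ} (hC : IsUnit C.det)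
    (k : Fin d → ℤ) (η : Fin d → ℝ) :
    planeWave (latticePoint C k) (matrixMap (dualMatrix C) η) = charInt k η := by
  have h : inner ℝ (latticePoint C k) (matrixMap (dualMatrix C) η) = ∑ i, (k i : ℝ) * η i := by
    rw [latticePoint, matrixMap, EuclideanSpace.inner_toLp_toLp, star_trivial, dualMatrix,
      dotProduct_comm, Matrix.dotProduct_mulVec, Matrix.vecMul_mulVec,
      Matrix.mul_nonsing_inv _ (by rwa [Matrix.det_transpose]), Matrix.vecMul_one]
    rfl
  rw [planeWave, h, Real.fourierChar_apply, charInt]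
  push_cast
  congr 1
  ring

lemma measurableEmbedding_matrixMap {d : ℕ} {A : Matrix (Fin d) (Fin d) ℝ} (hA : IsUnit A.det) :
    MeasurableEmbedding (matrixMap A) := by
  refine (continuous_matrixMap A).measurableEmbedding fun x y hxy => ?_
  exact Matrix.mulVec_injective_of_isUnit ((Matrix.isUnit_iff_isUnit_det A).2 hA)
    (WithLp.toLp_injective 2 hxy)

lemma map_matrixMap_volume {d : ℕ} {A : Matrix (Fin d) (Fin d) ℝ} (hA : IsUnit A.det) :
    (volume : Measure (Fin d → ℝ)).map (matrixMap A) = ENNReal.ofReal |A.det⁻¹| • volume := by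
  have h1 : matrixMap A = WithLp.toLp 2 ∘ Matrix.toLin' A := by
    funext x
    simp [matrixMap]
  have hm := (PiLp.volume_preserving_toLp (Fin d)).measurable
  rw [h1, ← Measure.map_map hm (LinearMap.continuous_of_finiteDimensional _).measurable,
    Real.map_matrix_volume_pi_eq_smul_volume_pi hA.ne_zero, Measure.map_smul,
    (PiLp.volume_preserving_toLp (Fin d)).map_eq]

lemma integral_comp_dualMatrixMap {d : ℕ} {C : Matrix (Fin d) (Fin d) ℝ} (hC : IsUnit C.det)
    (H : EuclideanSpace ℝ (Fin d) → ℂ) :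
    ∫ ξ, H ξ = ((|C.det|⁻¹ : ℝ) : ℂ) * ∫ η, H (matrixMap (dualMatrix C) η) := by
  rw [← (measurableEmbedding_matrixMap (isUnit_det_dualMatrix hC)).integral_map,
    map_matrixMap_volume (isUnit_det_dualMatrix hC), integral_smul_measure, det_dualMatrix, inv_inv,
    ENNReal.toReal_ofReal (abs_nonneg _), Complex.real_smul, ← mul_assoc, ← Complex.ofReal_mul,
    inv_mul_cancel₀ (abs_ne_zero.2 hC.ne_zero), Complex.ofReal_one, one_mul]

lemma memLp_comp_matrixMap {d : ℕ} {A : Matrix (Fin d) (Fin d) ℝ} (hA : IsUnit A.det)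
    {F : EuclideanSpace ℝ (Fin d) → ℂ} (hF : MemLp F 2 volume) :
    MemLp (fun η => F (matrixMap A η)) 2 volume := by
  refine (measurableEmbedding_matrixMap hA).memLp_map_measure_iff.1 ?_
  rw [map_matrixMap_volume hA]
  exact hF.smul_measure ENNReal.ofReal_ne_top

lemma exists_bound_matrixMap {d : ℕ} {A : Matrix (Fin d) (Fin d) ℝ} (hA : IsUnit A.det) (R : ℝ) :
    ∃ R', ∀ η, R' < ‖η‖ → R < ‖matrixMap A η‖ := by
  have hc : Continuous fun ξ : EuclideanSpace ℝ (Fin d) => A⁻¹ *ᵥ ξ.ofLp := by fun_prop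
  obtain ⟨R', hR'⟩ := ((isCompact_closedBall (0 : EuclideanSpace ℝ (Fin d)) R).image
    hc).isBounded.exists_norm_le
  refine ⟨R', fun η hη => ?_⟩
  by_contra! hcon
  refine (not_le.2 hη) (hR' η ⟨matrixMap A η, by simpa using hcon, ?_⟩)
  simp [matrixMap, Matrix.mulVec_mulVec, Matrix.nonsing_inv_mul _ hA]

/-- Parseval's identity for the periodizations of two functions along the dual lattice of
`C ℤᵈ`. -/
lemma hasSum_parseval_lattice {d : ℕ} {C : Matrix (Fin d) (Fin d) ℝ} (hC : IsUnit C.det)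
    {F G : EuclideanSpace ℝ (Fin d) → ℂ} (hF : MemLp F 2 volume) (hG : MemLp G 2 volume) {R : ℝ}
    (hFR : ∀ ξ, R < ‖ξ‖ → F ξ = 0) (hGR : ∀ ξ, R < ‖ξ‖ → G ξ = 0) :
    ∃ v, HasSum (fun k : Fin d → ℤ => (∫ ξ, F ξ * planeWave (latticePoint C k) ξ) *
      starRingEnd ℂ (∫ ξ, G ξ * planeWave (latticePoint C k) ξ)) v ∧
      HasSum (fun l : Fin d → ℤ => ((|C.det|⁻¹ : ℝ) : ℂ) *
        ∫ ξ, F ξ * starRingEnd ℂ (G (ξ - latticePoint (dualMatrix C) l))) v := by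
  have hD := isUnit_det_dualMatrix hC
  obtain ⟨R', hR'⟩ := exists_bound_matrixMap hD R
  obtain ⟨v, hv1, hv2⟩ := hasSum_parseval_periodization (memLp_comp_matrixMap hD hF)
    (memLp_comp_matrixMap hD hG) (fun x hx => hFR _ (hR' x hx)) (fun x hx => hGR _ (hR' x hx))
  -- On the coefficient side each of the two integrals contributes a Jacobian; on the other side one
  -- factor is the Jacobian and the other is explicit in the statement.
  refine ⟨((|C.det|⁻¹ : ℝ) : ℂ) * (((|C.det|⁻¹ : ℝ) : ℂ) * v), ?_, ?_⟩
  · refine HasSum.congr_fun ((hv1.mul_left ((|C.det|⁻¹ : ℝ) : ℂ)).mul_left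
      ((|C.det|⁻¹ : ℝ) : ℂ)) fun k => ?_
    rw [integral_comp_dualMatrixMap hC, integral_comp_dualMatrixMap hC (fun ξ => G ξ * _)]
    simp_rw [planeWave_matrixMap hC, map_mul, Complex.conj_ofReal]
    ring
  · refine HasSum.congr_fun ((hv2.mul_left ((|C.det|⁻¹ : ℝ) : ℂ)).mul_left
      ((|C.det|⁻¹ : ℝ) : ℂ)) fun l => ?_
    rw [integral_comp_dualMatrixMap hC]
    simp_rw [matrixMap_sub_intVec]

/-! ### The Fourier transform of a translation -/

lemma memLp_planeWave_mul {d : ℕ} (a : EuclideanSpace ℝ (Fin d)) {F : EuclideanSpace ℝ (Fin d) → ℂ}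
    {p : ℝ≥0∞} (hF : MemLp F p volume) : MemLp (fun ξ => planeWave a ξ * F ξ) p volume := by
  refine hF.of_le ((continuous_planeWave a).aestronglyMeasurable.mul hF.1) (ae_of_all _ fun ξ => ?_)
  rw [norm_mul, norm_planeWave, one_mul]

/-- Multiplication by the character `planeWave a` on `L²`. -/
noncomputable def modulateL2 {d : ℕ} (a : EuclideanSpace ℝ (Fin d)) (f : L2 d) : L2 d :=
  (memLp_planeWave_mul a (Lp.memLp f)).toLp

lemma coeFn_modulateL2 {d : ℕ} (a : EuclideanSpace ℝ (Fin d)) (f : L2 d) :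
    modulateL2 a f =ᵐ[volume] fun ξ => planeWave a ξ * f ξ :=
  MemLp.coeFn_toLp _

lemma isometry_modulateL2 {d : ℕ} (a : EuclideanSpace ℝ (Fin d)) :
    Isometry (modulateL2 a : L2 d → L2 d) := by
  intro f g
  rw [modulateL2, modulateL2, Lp.edist_toLp_toLp, Lp.edist_def]
  refine eLpNorm_congr_norm_ae (ae_of_all _ fun ξ => ?_)
  simp only [Pi.sub_apply, ← mul_sub, norm_mul, norm_planeWave, one_mul]

/-- Both sides are continuous in `f`, so it suffices to treat Schwartz functions, where the
transform is an integral. -/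
lemma fourier_translateL2 {d : ℕ} (a : EuclideanSpace ℝ (Fin d)) (f : L2 d) :
    (𝓕 (translateL2 a f) : L2 d) = modulateL2 (-a) (𝓕 f) := by
  refine DenseRange.induction_on (p := fun f : L2 d =>
    (𝓕 (translateL2 a f) : L2 d) = modulateL2 (-a) (𝓕 f))
    (SchwartzMap.denseRange_toLpCLM (p := 2) ENNReal.ofNat_ne_top) f ?_ ?_
  · refine isClosed_eq ?_ ?_
    · exact (Lp.fourierTransformₗᵢ _ ℂ).continuous.comp
        (Lp.isometry_compMeasurePreserving (measurePreserving_sub_right volume a)).continuous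
    · exact (isometry_modulateL2 (-a)).continuous.comp (Lp.fourierTransformₗᵢ _ ℂ).continuous
  · intro φ
    have h1 : translateL2 a (φ.toLp 2) = (φ.compSubConstCLM ℂ a).toLp 2 := rfl
    rw [SchwartzMap.toLpCLM_apply, h1, SchwartzMap.toLp_fourier_eq, SchwartzMap.toLp_fourier_eq]
    refine Lp.ext ?_
    filter_upwards [coeFn_modulateL2 (-a) ((𝓕 φ).toLp 2), (𝓕 φ).coeFn_toLp 2 volume,
      (𝓕 (φ.compSubConstCLM ℂ a)).coeFn_toLp 2 volume] with ξ h2 h3 h4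
    rw [h4, h2, h3, SchwartzMap.fourier_coe, SchwartzMap.fourier_coe]
    have h5 := congrFun (VectorFourier.fourierIntegral_comp_add_right Real.fourierChar
      (volume : Measure (EuclideanSpace ℝ (Fin d))) (innerₗ _) φ (-a)) ξ
    exact h5

/-! ### The mixed frame operator of two Bessel sequences -/

section Bessel

variable {H J : Type*} [NormedAddCommGroup H] [InnerProductSpace ℂ H]

lemma IsBessel.exists_nonneg_bound {y : J → H} (hy : IsBessel y) :
    ∃ B : ℝ, 0 ≤ B ∧ ∀ v : H, Summable (fun j => ‖inner ℂ (y j) v‖ ^ 2) ∧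
      ∑' j, ‖inner ℂ (y j) v‖ ^ 2 ≤ B * ‖v‖ ^ 2 := by
  obtain ⟨B, hB⟩ := hy
  refine ⟨max B 0, le_max_right _ _, fun v => ⟨(hB v).1, (hB v).2.trans ?_⟩⟩
  gcongr
  exact le_max_left _ _

/-- The synthesis operator is adjoint to the analysis operator and has the same bound: expand `‖w‖²
= ⟨w, w⟩` in one slot, apply Cauchy–Schwarz and the Bessel bound at `w`, and divide by `‖w‖²`. -/
lemma norm_sum_smul_sq_le {y : J → H} {B : ℝ} (hB0 : 0 ≤ B)
    (hB : ∀ v : H, Summable (fun j => ‖inner ℂ (y j) v‖ ^ 2) ∧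
      ∑' j, ‖inner ℂ (y j) v‖ ^ 2 ≤ B * ‖v‖ ^ 2) (c : J → ℂ) (s : Finset J) :
    ‖∑ j ∈ s, c j • y j‖ ^ 2 ≤ B * ∑ j ∈ s, ‖c j‖ ^ 2 := by
  set w := ∑ j ∈ s, c j • y j with hw
  have h1 : ‖w‖ ^ 2 ≤ ∑ j ∈ s, ‖c j‖ * ‖inner ℂ (y j) w‖ := by
    have h2 : ((‖w‖ ^ 2 : ℝ) : ℂ) = ∑ j ∈ s, starRingEnd ℂ (c j) * inner ℂ (y j) w := by
      have h3 := inner_self_eq_norm_sq_to_K (𝕜 := ℂ) w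
      rw [Complex.ofReal_pow]
      refine h3.symm.trans ?_
      conv_lhs => rw [hw, sum_inner]
      simp_rw [inner_smul_left, hw]
    calc ‖w‖ ^ 2 = ‖((‖w‖ ^ 2 : ℝ) : ℂ)‖ := by
          rw [Complex.norm_real, Real.norm_of_nonneg (sq_nonneg _)]
      _ ≤ _ := by
          rw [h2]
          refine (norm_sum_le _ _).trans (le_of_eq ?_)
          simp
  have h4 : (∑ j ∈ s, ‖c j‖ * ‖inner ℂ (y j) w‖) ^ 2 ≤
      (∑ j ∈ s, ‖c j‖ ^ 2) * (B * ‖w‖ ^ 2) := by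
    refine (Finset.sum_mul_sq_le_sq_mul_sq s _ _).trans ?_
    gcongr
    exact ((hB w).1.sum_le_tsum s fun _ _ => sq_nonneg _).trans (hB w).2
  rcases eq_or_ne ‖w‖ 0 with h0 | h0
  · rw [h0, zero_pow two_ne_zero]
    positivity
  · have h5 : (‖w‖ ^ 2) ^ 2 ≤ (∑ j ∈ s, ‖c j‖ ^ 2) * (B * ‖w‖ ^ 2) :=
      (pow_le_pow_left₀ (sq_nonneg _) h1 2).trans h4
    have h6 : 0 < ‖w‖ ^ 2 := by positivity
    nlinarith

lemma IsBessel.summable_smul [CompleteSpace H] {y : J → H} (hy : IsBessel y) {c : J → ℂ}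
    (hc : Summable fun j => ‖c j‖ ^ 2) : Summable fun j => c j • y j := by
  obtain ⟨B, hB0, hB⟩ := hy.exists_nonneg_bound
  rw [summable_iff_vanishing_norm]
  intro ε hε
  -- `B + 1` rather than `B`, since `B` may be zero.
  obtain ⟨s, hs⟩ := summable_iff_vanishing_norm.1 hc (ε ^ 2 / (B + 1)) (by positivity)
  refine ⟨s, fun t ht => ?_⟩
  have h1 := norm_sum_smul_sq_le hB0 hB c t
  have h2 := hs t ht
  rw [Real.norm_of_nonneg (Finset.sum_nonneg fun _ _ => sq_nonneg _),
    lt_div_iff₀ (by positivity)] at h2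
  have h3 : (0 : ℝ) ≤ ∑ j ∈ t, ‖c j‖ ^ 2 := Finset.sum_nonneg fun _ _ => sq_nonneg _
  exact lt_of_pow_lt_pow_left₀ 2 hε.le (by nlinarith)

lemma exists_mixedFrameOperator [CompleteSpace H] {x y : J → H} (hx : IsBessel x)
    (hy : IsBessel y) :
    ∃ S : H →L[ℂ] H, ∀ v, HasSum (fun j => inner ℂ (x j) v • y j) (S v) := by
  have hsum : ∀ v, Summable fun j => inner ℂ (x j) v • y j := fun v => by
    obtain ⟨B, hB⟩ := hx
    exact hy.summable_smul (hB v).1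
  obtain ⟨A, hA0, hA⟩ := hx.exists_nonneg_bound
  obtain ⟨B, hB0, hB⟩ := hy.exists_nonneg_bound
  let S : H →ₗ[ℂ] H :=
    { toFun := fun v => ∑' j, inner ℂ (x j) v • y j
      map_add' := fun u v => by
        rw [← (hsum u).tsum_add (hsum v)]
        simp_rw [inner_add_right, add_smul]
      map_smul' := fun c v => by
        rw [RingHom.id_apply, ← (hsum v).tsum_const_smul c]
        simp_rw [inner_smul_right, mul_smul] }
  have hbound : ∀ v, ‖S v‖ ≤ Real.sqrt (B * A) * ‖v‖ := by
    intro v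
    have h1 : ‖S v‖ ^ 2 ≤ B * (A * ‖v‖ ^ 2) := by
      have h2 : Filter.Tendsto (fun s : Finset J => ‖∑ j ∈ s, inner ℂ (x j) v • y j‖ ^ 2)
          Filter.atTop (𝓝 (‖S v‖ ^ 2)) := ((hsum v).hasSum.norm).pow 2
      refine le_of_tendsto' h2 fun s => (norm_sum_smul_sq_le hB0 hB _ s).trans ?_
      gcongr
      exact ((hA v).1.sum_le_tsum s fun _ _ => sq_nonneg _).trans (hA v).2
    refine le_of_sq_le_sq ?_ (by positivity)
    rw [mul_pow, Real.sq_sqrt (by positivity)]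
    linarith
  exact ⟨S.mkContinuous _ hbound, fun v => (hsum v).hasSum⟩

end Bessel

/-! ### Uniqueness of almost periodic Fourier coefficients -/

section AlmostPeriodic

variable {d : ℕ}

lemma planeWave_zero_right (a : EuclideanSpace ℝ (Fin d)) : planeWave a 0 = 1 := by
  simp [planeWave]

lemma planeWave_comm (a b : EuclideanSpace ℝ (Fin d)) : planeWave a b = planeWave b a := by
  simp [planeWave, real_inner_comm]

lemma planeWave_add_right (a b c : EuclideanSpace ℝ (Fin d)) :
    planeWave a (b + c) = planeWave a b * planeWave a c := by
  simp [planeWave, inner_add_right, AddChar.map_add_eq_mul]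

lemma conj_planeWave (a b : EuclideanSpace ℝ (Fin d)) :
    starRingEnd ℂ (planeWave a b) = planeWave a (-b) := by
  rw [planeWave, planeWave, inner_neg_right, AddChar.map_neg_eq_inv, Circle.coe_inv_eq_conj]

/-- The integral of the character `planeWave v` over the unit ball. -/
noncomputable def ballMean (v : EuclideanSpace ℝ (Fin d)) : ℂ :=
  ∫ a in Metric.closedBall (0 : EuclideanSpace ℝ (Fin d)) 1, planeWave a v

lemma integrableOn_ball_planeWave_left (v : EuclideanSpace ℝ (Fin d)) :
    IntegrableOn (fun a => planeWave a v) (Metric.closedBall 0 1) volume := by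
  simp_rw [fun a => planeWave_comm a v]
  exact (continuous_planeWave v).continuousOn.integrableOn_compact (isCompact_closedBall _ _)

lemma norm_ballMean_le (v : EuclideanSpace ℝ (Fin d)) :
    ‖ballMean v‖ ≤ volume.real (Metric.closedBall (0 : EuclideanSpace ℝ (Fin d)) 1) := by
  have := norm_setIntegral_le_of_norm_le_const (μ := volume) (C := 1)
    (f := fun a => planeWave a v) (s := Metric.closedBall (0 : EuclideanSpace ℝ (Fin d)) 1)
    (isCompact_closedBall _ _).measure_lt_top (fun a _ => (norm_planeWave a v).le)
  simpa using! this

lemma ballMean_zero_ne_zero : ballMean (0 : EuclideanSpace ℝ (Fin d)) ≠ 0 := by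
  have h : (0 : ℝ) < volume.real (Metric.closedBall (0 : EuclideanSpace ℝ (Fin d)) 1) :=
    ENNReal.toReal_pos (Metric.measure_closedBall_pos _ _ one_pos).ne'
      (isCompact_closedBall _ _).measure_lt_top.ne
  simp only [ballMean, planeWave_zero_right, setIntegral_const, Complex.real_smul, mul_one]
  exact_mod_cast h.ne'

/-- The Riemann–Lebesgue lemma for the indicator of the unit ball. -/
lemma tendsto_ballMean_smul {v : EuclideanSpace ℝ (Fin d)} (hv : v ≠ 0) :
    Filter.Tendsto (fun n : ℕ => ballMean ((n : ℝ) • v)) Filter.atTop (𝓝 0) := by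
  have h1 := tendsto_integral_exp_inner_smul_cocompact
    ((Metric.closedBall (0 : EuclideanSpace ℝ (Fin d)) 1).indicator fun _ => (1 : ℂ))
  have h2 : Filter.Tendsto (fun n : ℕ => -((n : ℝ) • v)) Filter.atTop
      (Filter.cocompact (EuclideanSpace ℝ (Fin d))) := by
    rw [← Metric.cobounded_eq_cocompact, ← comap_norm_atTop, Filter.tendsto_comap_iff]
    simp only [Function.comp_def]
    simp_rw [norm_neg, norm_smul, Real.norm_natCast]
    exact tendsto_natCast_atTop_atTop.atTop_mul_const (norm_pos_iff.2 hv)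
  refine (h1.comp h2).congr fun n => ?_
  rw [Function.comp, ballMean, ← integral_indicator Metric.isClosed_closedBall.measurableSet]
  refine integral_congr_ae (ae_of_all _ fun a => ?_)
  by_cases ha : a ∈ Metric.closedBall (0 : EuclideanSpace ℝ (Fin d)) 1
  · simp [ha, planeWave, Circle.smul_def]
  · simp [ha]

lemma tendsto_ballMean_smul_ite (v : EuclideanSpace ℝ (Fin d)) :
    Filter.Tendsto (fun n : ℕ => ballMean ((n : ℝ) • v)) Filter.atTop
      (𝓝 (if v = 0 then ballMean (0 : EuclideanSpace ℝ (Fin d)) else 0)) := by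
  split_ifs with h
  · simp [h]
  · exact tendsto_ballMean_smul h

/-- An absolutely convergent trigonometric series with constant value `w` has all its
coefficients zero, except for the one at frequency zero, which is `w`. -/
lemma tsum_frequency_eq {J : Type*} [Countable J] (β : J → EuclideanSpace ℝ (Fin d)) {c : J → ℂ}
    (hc : Summable fun j => ‖c j‖) {w : ℂ} (hw : ∀ a, HasSum (fun j => planeWave a (β j) * c j) w)
    (α : EuclideanSpace ℝ (Fin d)) :
    ∑' j, (if β j - α = 0 then c j else 0) = if -α = 0 then w else 0 := by
  -- The series at the point `n • a` is multiplied by the conjugate character of frequency `α` and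
  -- integrated over `a` in the unit ball. This is a mean over the ball of radius `n`; as `n → ∞` it
  -- retains only the terms with `β j = α`.
  have key : ∀ n : ℕ, ∑' j, ballMean ((n : ℝ) • (β j - α)) * c j =
      ballMean ((n : ℝ) • (-α)) * w := by
    intro n
    have hpt : ∀ a : EuclideanSpace ℝ (Fin d), HasSum
        (fun j => planeWave a ((n : ℝ) • (β j - α)) * c j) (planeWave a ((n : ℝ) • (-α)) * w) := by
      intro a
      refine HasSum.congr_fun ((hw ((n : ℝ) • a)).mul_left (planeWave a ((n : ℝ) • (-α))))
        fun j => ?_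
      have : planeWave ((n : ℝ) • a) (β j) = planeWave a ((n : ℝ) • β j) := by
        simp [planeWave, inner_smul_left, inner_smul_right]
      rw [this, ← mul_assoc, ← planeWave_add_right]
      congr 2
      simp only [smul_sub, smul_neg]
      abel
    have h1 := hasSum_integral_of_summable_integral_norm
      (μ := volume.restrict (Metric.closedBall (0 : EuclideanSpace ℝ (Fin d)) 1))
      (F := fun j a => planeWave a ((n : ℝ) • (β j - α)) * c j)
      (fun j => (integrableOn_ball_planeWave_left _).mul_const _) (by
        simp_rw [norm_mul, norm_planeWave, one_mul, integral_const]
        exact hc.const_smul _)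
    simp_rw [(hpt _).tsum_eq, integral_mul_const] at h1
    exact h1.tsum_eq
  have hlim : Filter.Tendsto (fun n : ℕ => ∑' j, ballMean ((n : ℝ) • (β j - α)) * c j)
      Filter.atTop (𝓝 (∑' j, (if β j - α = 0 then ballMean (0 : EuclideanSpace ℝ (Fin d)) else 0) *
        c j)) :=
    tendsto_tsum_of_dominated_convergence (hc.mul_left _)
      (fun j => (tendsto_ballMean_smul_ite _).mul_const _)
      (Filter.Eventually.of_forall fun n j => by
        rw [norm_mul]
        gcongr
        exact norm_ballMean_le _)
  simp_rw [key] at hlim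
  have h2 := tendsto_nhds_unique hlim ((tendsto_ballMean_smul_ite (-α)).mul_const w)
  simp_rw [ite_mul, zero_mul, ← mul_ite_zero, tsum_mul_left] at h2
  exact mul_left_cancel₀ ballMean_zero_ne_zero h2

end AlmostPeriodic

/-! ### Inner products with translations, on the Fourier side -/

lemma inner_translateL2 {d : ℕ} (a : EuclideanSpace ℝ (Fin d)) (g f : L2 d) :
    inner ℂ (translateL2 a g) f =
      ∫ ξ, (𝓕 f : L2 d) ξ * starRingEnd ℂ ((𝓕 g : L2 d) ξ) * planeWave a ξ := by
  rw [← Lp.inner_fourier_eq, fourier_translateL2, L2.inner_def]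
  refine integral_congr_ae ?_
  filter_upwards [coeFn_modulateL2 (-a) (𝓕 g : L2 d)] with ξ h
  rw [h, RCLike.inner_apply, map_mul, conj_planeWave, planeWave_comm, planeWave, inner_neg_left,
    inner_neg_right, neg_neg]
  rw [planeWave, real_inner_comm]
  ring

/-! ### The essential support -/

lemma isClosed_essSupport {d : ℕ} (u : EuclideanSpace ℝ (Fin d) → ℂ) : IsClosed (essSupport u) := by
  rw [← isOpen_compl_iff, isOpen_iff_mem_nhds]
  intro ξ hξ
  simp only [essSupport, Set.mem_compl_iff, Set.mem_ofPred_eq, not_forall, not_not] at hξ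
  obtain ⟨U, hU, hu⟩ := hξ
  filter_upwards [eventually_mem_nhds_iff.2 hU] with η hη
  exact fun h => h U hη hu

lemma essSupport_subset {d : ℕ} {u : EuclideanSpace ℝ (Fin d) → ℂ}
    {K : Set (EuclideanSpace ℝ (Fin d))} (hK : IsClosed K) (hu : ∀ᵐ ξ, ξ ∉ K → u ξ = 0) :
    essSupport u ⊆ K := by
  intro ξ hξ
  by_contra hcon
  exact hξ Kᶜ (hK.isOpen_compl.mem_nhds hcon) hu

/-- The exceptional set is locally null, hence null because the space is second countable. -/
lemma ae_mem_essSupport {d : ℕ} (u : EuclideanSpace ℝ (Fin d) → ℂ) :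
    ∀ᵐ ξ, u ξ ≠ 0 → ξ ∈ essSupport u := by
  have : ∀ᵐ ξ, ξ ∉ {ξ | u ξ ≠ 0 ∧ ξ ∉ essSupport u} := by
    rw [← measure_eq_zero_iff_ae_notMem]
    refine measure_null_of_locally_null _ fun ξ hξ => ?_
    have h := hξ.2
    simp only [essSupport, Set.mem_ofPred_eq, not_forall, not_not] at h
    obtain ⟨U, hU, hu⟩ := h
    refine ⟨U ∩ {ξ | u ξ ≠ 0 ∧ ξ ∉ essSupport u},
      Filter.inter_mem (mem_nhdsWithin_of_mem_nhds hU) self_mem_nhdsWithin, ?_⟩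
    rw [measure_eq_zero_iff_ae_notMem]
    filter_upwards [hu] with η h1 h2
    exact h2.2.1 (h1 h2.1)
  filter_upwards [this] with ξ h1 h2
  by_contra h3
  exact h1 ⟨h2, h3⟩

/-! ### Spherical shells and the local integrability condition -/

/-- Closed shells exhausting `ℝᵈ` up to the origin (balls when `d = 0`). -/
def shell (d n : ℕ) : Set (EuclideanSpace ℝ (Fin d)) :=
  {ξ | ‖ξ‖ ≤ n + 1 ∧ (d = 0 ∨ 1 / ((n : ℝ) + 1) ≤ ‖ξ‖)}

lemma isCompact_shell (d n : ℕ) : IsCompact (shell d n) := by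
  refine (isCompact_closedBall (0 : EuclideanSpace ℝ (Fin d)) (n + 1)).of_isClosed_subset ?_
    fun ξ hξ => by simpa using hξ.1
  refine (isClosed_le continuous_norm continuous_const).inter
    (?_ : IsClosed {ξ : EuclideanSpace ℝ (Fin d) | d = 0 ∨ 1 / ((n : ℝ) + 1) ≤ ‖ξ‖})
  rcases eq_or_ne d 0 with h | h
  · simp [h]
  · simpa [h] using isClosed_le continuous_const (continuous_norm (E := EuclideanSpace ℝ (Fin d)))

lemma measurableSet_shell (d n : ℕ) : MeasurableSet (shell d n) :=
  (isCompact_shell d n).measurableSet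

lemma exists_mem_shell {d : ℕ} {ξ : EuclideanSpace ℝ (Fin d)} (hξ : d = 0 ∨ ξ ≠ 0) :
    ∃ N, ∀ n ≥ N, ξ ∈ shell d n := by
  obtain ⟨N1, hN1⟩ := exists_nat_ge ‖ξ‖
  rcases hξ with hd | hξ
  · refine ⟨N1, fun n hn => ⟨?_, Or.inl hd⟩⟩
    have : (N1 : ℝ) ≤ n := by exact_mod_cast hn
    linarith
  · obtain ⟨N2, hN2⟩ := exists_nat_one_div_lt (norm_pos_iff.2 hξ)
    refine ⟨max N1 N2, fun n hn => ⟨?_, Or.inr ?_⟩⟩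
    · have : (N1 : ℝ) ≤ n := by exact_mod_cast (le_max_left _ _).trans hn
      linarith
    · have : (N2 : ℝ) ≤ n := by exact_mod_cast (le_max_right _ _).trans hn
      refine le_trans ?_ hN2.le
      gcongr

/-- For `d > 0` the shells miss only the origin, a null set. For `d = 0` the origin carries all the
mass, which is why `shell` then includes it. -/
lemma ae_mem_shell (d : ℕ) : ∀ᵐ ξ : EuclideanSpace ℝ (Fin d), ∃ N, ∀ n ≥ N, ξ ∈ shell d n := by
  rcases Nat.eq_zero_or_pos d with hd | hd
  · exact ae_of_all _ fun ξ => exists_mem_shell (Or.inl hd)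
  · have : Nonempty (Fin d) := ⟨⟨0, hd⟩⟩
    filter_upwards [Measure.ae_ne volume (0 : EuclideanSpace ℝ (Fin d))] with ξ hξ
    exact exists_mem_shell (Or.inr hξ)

/-- The local integrability condition for a single set `K`. -/
def ShiftIntegrableOn {d : ℕ} {P : Type*} (C : P → Matrix (Fin d) (Fin d) ℝ) (g : P → L2 d)
    (K : Set (EuclideanSpace ℝ (Fin d))) : Prop :=
  ∑' p, ∑' k : Fin d → ℤ, ∫⁻ ξ in K,
    K.indicator (fun _ => (1 : ℝ≥0∞)) (ξ + latticePoint (dualMatrix (C p)) k) *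
      ENNReal.ofReal (|(C p).det|⁻¹) * ‖(𝓕 (g p) : L2 d) ξ‖ₑ ^ 2 < ∞

/-- The condition is tested on the function whose Fourier transform is the indicator of the shell.
In dimension zero this function is not admissible, its support containing the origin. -/
lemma LocallyIntegrableSystem.shiftIntegrableOn_shell {d : ℕ} {P : Type*} (hd : d ≠ 0)
    {C : P → Matrix (Fin d) (Fin d) ℝ} {g : P → L2 d} (hg : LocallyIntegrableSystem C g) (n : ℕ) :
    ShiftIntegrableOn C g (shell d n) := by
  have hmem : ∀ q, MemLp ((shell d n).indicator fun _ => (1 : ℂ)) q volume := fun q =>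
    memLp_indicator_const q (measurableSet_shell d n) 1
      (Or.inr (isCompact_shell d n).measure_lt_top.ne)
  set f : L2 d := 𝓕⁻ (hmem 2).toLp with hf
  have hff : (𝓕 f : L2 d) = (hmem 2).toLp := FourierTransform.fourier_fourierInv_eq _
  have hae : (𝓕 f : L2 d) =ᵐ[volume] (shell d n).indicator fun _ => (1 : ℂ) := by
    rw [hff]
    exact (hmem 2).coeFn_toLp
  have hsub : essSupport (𝓕 f : L2 d) ⊆ shell d n := by
    refine essSupport_subset (isCompact_shell d n).isClosed ?_
    filter_upwards [hae] with ξ h1 h2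
    rw [h1, Set.indicator_of_notMem h2]
  have hsup : shell d n ≤ᵐ[volume] essSupport (𝓕 f : L2 d) := by
    filter_upwards [hae, ae_mem_essSupport (𝓕 f : L2 d)] with ξ h1 h2 h3
    refine h2 ?_
    rw [h1, Set.indicator_of_mem (s := shell d n) h3]
    exact one_ne_zero
  have hf1 : f ∈ testClass d := by
    refine ⟨(memLp_congr_ae hae).2 (hmem ∞),
      (isCompact_shell d n).of_isClosed_subset (isClosed_essSupport _) hsub, fun h0 => ?_⟩
    have h1 := (hsub h0).2.resolve_left hd
    rw [norm_zero] at h1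
    exact absurd h1 (not_le.2 (by positivity))
  refine lt_of_le_of_lt (ENNReal.tsum_le_tsum fun p => ENNReal.tsum_le_tsum fun k => ?_) (hg f hf1)
  refine le_trans (le_of_eq ?_) (lintegral_mono_set' hsup)
  refine lintegral_congr_ae (ae_restrict_of_ae ?_)
  filter_upwards [(measurePreserving_add_right volume
    (latticePoint (dualMatrix (C p)) k)).quasiMeasurePreserving.ae hae] with ξ h
  rw [h]
  by_cases hξ : ξ + latticePoint (dualMatrix (C p)) k ∈ shell d n
  · simp [Set.indicator_of_mem hξ]
  · simp [Set.indicator_of_notMem hξ]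

lemma integral_euclideanSpace_zero (F : EuclideanSpace ℝ (Fin 0) → ℂ) : ∫ ξ, F ξ = F 0 := by
  rw [volume_euclideanSpace_eq_dirac, integral_dirac]

lemma lintegral_euclideanSpace_zero (F : EuclideanSpace ℝ (Fin 0) → ℝ≥0∞) : ∫⁻ ξ, F ξ = F 0 := by
  rw [volume_euclideanSpace_eq_dirac, lintegral_dirac]

/-- In dimension zero every nonzero function has the origin in its support, so local integrability
is vacuous. The Bessel inequality for the constant `1` replaces it: it gives `∑ₚ |ĝₚ(0)|² < ∞`, and
the lattices and determinants are trivial. -/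
lemma IsBessel.shiftIntegrableOn_zero {P : Type*}
    {C : P → Matrix (Fin 0) (Fin 0) ℝ} {g : P → L2 0} (hg : IsBessel (translationSystem C g))
    (K : Set (EuclideanSpace ℝ (Fin 0))) : ShiftIntegrableOn C g K := by
  have hmem : MemLp (fun _ => (1 : ℂ)) 2 (volume : Measure (EuclideanSpace ℝ (Fin 0))) := by
    rw [volume_euclideanSpace_eq_dirac]
    exact memLp_const 1
  set f : L2 0 := 𝓕⁻ hmem.toLp with hf
  have hff : (𝓕 f : L2 0) = hmem.toLp := FourierTransform.fourier_fourierInv_eq _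
  have hae : (𝓕 f : L2 0) =ᵐ[volume] fun _ => (1 : ℂ) := by
    rw [hff]
    exact hmem.coeFn_toLp
  obtain ⟨B, hB⟩ := hg
  have h1 : Summable fun p => ‖(𝓕 (g p) : L2 0) 0‖ ^ 2 := by
    refine ((hB f).1.comp_injective (i := fun p : P => (p, 0))
      (fun p q hpq => (Prod.ext_iff.1 hpq).1)).congr fun p => ?_
    rw [Function.comp, translationSystem, inner_translateL2]
    have h2 : ∫ ξ, (𝓕 f : L2 0) ξ * starRingEnd ℂ ((𝓕 (g p) : L2 0) ξ) *
        planeWave (latticePoint (C p) 0) ξ = ∫ ξ, 1 * starRingEnd ℂ ((𝓕 (g p) : L2 0) ξ) *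
        planeWave (latticePoint (C p) 0) ξ := by
      refine integral_congr_ae ?_
      filter_upwards [hae] with ξ h
      rw [h]
    rw [h2, integral_euclideanSpace_zero, norm_mul, norm_mul, norm_planeWave]
    simp
  refine lt_of_le_of_lt (ENNReal.tsum_le_tsum fun p => ?_) (lt_top_iff_ne_top.2 h1.tsum_ofReal_ne_top)
  rw [tsum_fintype, Fintype.sum_unique]
  refine (lintegral_mono' Measure.restrict_le_self le_rfl).trans ?_
  rw [lintegral_euclideanSpace_zero, Matrix.det_isEmpty, abs_one, inv_one,
    ENNReal.ofReal_one, mul_one, ENNReal.ofReal_pow (norm_nonneg _), ofReal_norm]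
  refine mul_le_of_le_one_left zero_le ?_
  exact Set.indicator_le_self' (fun _ _ => zero_le) _

lemma shiftIntegrableOn_shell {d : ℕ} {P : Type*} {C : P → Matrix (Fin d) (Fin d) ℝ}
    {g : P → L2 d} (hgB : IsBessel (translationSystem C g)) (hgL : LocallyIntegrableSystem C g)
    (n : ℕ) : ShiftIntegrableOn C g (shell d n) := by
  rcases Nat.eq_zero_or_pos d with rfl | hd
  · exact hgB.shiftIntegrableOn_zero _
  · exact hgL.shiftIntegrableOn_shell hd.ne' n

lemma latticePoint_zero {d : ℕ} (A : Matrix (Fin d) (Fin d) ℝ) : latticePoint A 0 = 0 := by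
  simp only [latticePoint, Pi.zero_apply, Int.cast_zero]
  exact congrArg (WithLp.toLp 2) (Matrix.mulVec_zero A)

lemma latticePoint_neg {d : ℕ} (A : Matrix (Fin d) (Fin d) ℝ) (k : Fin d → ℤ) :
    latticePoint A (-k) = -latticePoint A k := by
  rw [latticePoint, latticePoint, ← WithLp.toLp_neg, ← Matrix.mulVec_neg]
  congr 2
  funext i
  simp

/-- The series `∑ₚ |det Cₚ|⁻¹ |ĝₚ(ξ)|²` converges almost everywhere. -/
lemma ae_tsum_fourier_sq_lt_top {d : ℕ} {P : Type*} [Countable P]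
    {C : P → Matrix (Fin d) (Fin d) ℝ} {g : P → L2 d}
    (hg : ∀ n, ShiftIntegrableOn C g (shell d n)) :
    ∀ᵐ ξ, ∑' p, ENNReal.ofReal (|(C p).det|⁻¹) * ‖(𝓕 (g p) : L2 d) ξ‖ₑ ^ 2 < ∞ := by
  have hn : ∀ n, ∀ᵐ ξ, ξ ∈ shell d n →
      ∑' p, ENNReal.ofReal (|(C p).det|⁻¹) * ‖(𝓕 (g p) : L2 d) ξ‖ₑ ^ 2 < ∞ := by
    intro n
    rw [← ae_restrict_iff' (measurableSet_shell d n)]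
    have hm : ∀ p, AEMeasurable (fun ξ => ENNReal.ofReal (|(C p).det|⁻¹) *
        ‖(𝓕 (g p) : L2 d) ξ‖ₑ ^ 2) (volume.restrict (shell d n)) := fun p =>
      (((Lp.aestronglyMeasurable _).restrict.enorm).pow_const 2).const_mul _
    refine ae_lt_top' (AEMeasurable.tsum hm) ?_
    rw [lintegral_tsum hm]
    refine ne_of_lt (lt_of_le_of_lt (ENNReal.tsum_le_tsum fun p => ?_) (hg n))
    -- Only the `k = 0` terms of the local integrability condition are needed here.
    refine le_trans (le_of_eq ?_) (ENNReal.le_tsum (0 : Fin d → ℤ))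
    refine setLIntegral_congr_fun (measurableSet_shell d n) fun ξ hξ => ?_
    simp only [latticePoint_zero, add_zero, Set.indicator_of_mem hξ, one_mul]
  filter_upwards [ae_all_iff.2 hn, ae_mem_shell d] with ξ h1 ⟨N, hN⟩
  exact h1 N (hN N le_rfl)

/-! ### The cross terms of the mixed frame operator on the Fourier side -/

/-- Bounded measurable functions vanishing outside `K`. -/
structure IsTestOn {d : ℕ} (K : Set (EuclideanSpace ℝ (Fin d)))
    (φ : EuclideanSpace ℝ (Fin d) → ℂ) : Prop where
  measurable : Measurable φ
  bounded : ∃ M : ℝ, ∀ ξ, ‖φ ξ‖ ≤ M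
  vanish : ∀ ξ, ξ ∉ K → φ ξ = 0

lemma IsTestOn.memLp {d : ℕ} {K : Set (EuclideanSpace ℝ (Fin d))}
    {φ : EuclideanSpace ℝ (Fin d) → ℂ} (hφ : IsTestOn K φ) (hK : IsCompact K) (q : ℝ≥0∞) :
    MemLp φ q volume := by
  obtain ⟨M, hM⟩ := hφ.bounded
  refine (memLp_indicator_const q hK.measurableSet (M : ℂ) (Or.inr hK.measure_lt_top.ne)).of_le
    hφ.measurable.aestronglyMeasurable (ae_of_all _ fun ξ => ?_)
  by_cases hξ : ξ ∈ K
  · rw [Set.indicator_of_mem hξ, Complex.norm_real]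
    exact (hM ξ).trans (le_abs_self M)
  · simp [hφ.vanish ξ hξ]

section CrossTerms

variable {d : ℕ} {P : Type*} (C : P → Matrix (Fin d) (Fin d) ℝ) (g h : P → L2 d)

/-- The `p`-th summand of the series in the duality condition at frequency `α`. -/
noncomputable def dualTerm (α : EuclideanSpace ℝ (Fin d)) (p : P)
    (ξ : EuclideanSpace ℝ (Fin d)) : ℂ :=
  ((|(C p).det|⁻¹ : ℝ) : ℂ) * starRingEnd ℂ ((𝓕 (h p) : L2 d) (ξ - α)) * (𝓕 (g p) : L2 d) ξ

/-- The integrand of the term of the mixed frame operator with index `p` and frequency `α`. -/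
noncomputable def pairTerm (φ ψ : EuclideanSpace ℝ (Fin d) → ℂ) (α : EuclideanSpace ℝ (Fin d))
    (p : P) (ξ : EuclideanSpace ℝ (Fin d)) : ℂ :=
  φ ξ * starRingEnd ℂ (ψ (ξ - α)) * starRingEnd ℂ (dualTerm C g h α p ξ)

/-- The frequency `C_p' k`. -/
noncomputable def frequency (j : P × (Fin d → ℤ)) : EuclideanSpace ℝ (Fin d) :=
  latticePoint (dualMatrix (C j.1)) j.2

variable {C g h}

lemma ENNReal_mul_le_sq_add_sq (x y : ℝ≥0∞) : x * y ≤ x ^ 2 + y ^ 2 := by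
  rcases le_total x y with hxy | hxy
  · calc x * y ≤ y * y := by gcongr
      _ ≤ _ := by rw [← sq]; exact le_add_self
  · calc x * y ≤ x * x := by gcongr
      _ ≤ _ := by rw [← sq]; exact le_self_add

lemma enorm_dualTerm (α : EuclideanSpace ℝ (Fin d)) (p : P) (ξ : EuclideanSpace ℝ (Fin d)) :
    ‖dualTerm C g h α p ξ‖ₑ = ENNReal.ofReal (|(C p).det|⁻¹) *
      (‖(𝓕 (h p) : L2 d) (ξ - α)‖ₑ * ‖(𝓕 (g p) : L2 d) ξ‖ₑ) := by
  rw [dualTerm, enorm_mul, enorm_mul, RCLike.enorm_conj, mul_assoc]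
  congr 1
  rw [← ofReal_norm, Complex.norm_real, Real.norm_of_nonneg (by positivity)]

lemma enorm_dualTerm_le (α : EuclideanSpace ℝ (Fin d)) (p : P) (ξ : EuclideanSpace ℝ (Fin d)) :
    ‖dualTerm C g h α p ξ‖ₑ ≤
      ENNReal.ofReal (|(C p).det|⁻¹) * ‖(𝓕 (h p) : L2 d) (ξ - α)‖ₑ ^ 2 +
        ENNReal.ofReal (|(C p).det|⁻¹) * ‖(𝓕 (g p) : L2 d) ξ‖ₑ ^ 2 := by
  rw [enorm_dualTerm, ← mul_add]
  gcongr
  exact ENNReal_mul_le_sq_add_sq _ _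

lemma aestronglyMeasurable_dualTerm (α : EuclideanSpace ℝ (Fin d)) (p : P) :
    AEStronglyMeasurable (dualTerm C g h α p) volume := by
  have h1 : AEStronglyMeasurable (fun ξ => (𝓕 (h p) : L2 d) (ξ - α)) volume :=
    (Lp.aestronglyMeasurable (𝓕 (h p) : L2 d)).comp_measurePreserving
      (measurePreserving_sub_right volume α)
  exact ((RCLike.continuous_conj.comp_aestronglyMeasurable h1).const_mul _).mul
    (Lp.aestronglyMeasurable (𝓕 (g p) : L2 d))

lemma aestronglyMeasurable_pairTerm {K : Set (EuclideanSpace ℝ (Fin d))}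
    {φ ψ : EuclideanSpace ℝ (Fin d) → ℂ} (hφ : IsTestOn K φ) (hψ : IsTestOn K ψ)
    (α : EuclideanSpace ℝ (Fin d)) (p : P) :
    AEStronglyMeasurable (pairTerm C g h φ ψ α p) volume := by
  have h1 : Measurable fun ξ => ψ (ξ - α) := hψ.measurable.comp (measurable_id.sub_const α)
  exact (hφ.measurable.aestronglyMeasurable.mul
    (RCLike.continuous_conj.comp_aestronglyMeasurable h1.aestronglyMeasurable)).mul
    (RCLike.continuous_conj.comp_aestronglyMeasurable (aestronglyMeasurable_dualTerm α p))

/-- This guarantees that the `tsum` defining `dualSum` is almost everywhere a true sum and not the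
default value `0`. -/
lemma ae_summable_dualTerm [Countable P] (hg : ∀ n, ShiftIntegrableOn C g (shell d n))
    (hh : ∀ n, ShiftIntegrableOn C h (shell d n)) (α : EuclideanSpace ℝ (Fin d)) :
    ∀ᵐ ξ, Summable fun p => dualTerm C g h α p ξ := by
  filter_upwards [ae_tsum_fourier_sq_lt_top hg,
    (measurePreserving_sub_right volume α).quasiMeasurePreserving.ae
      (ae_tsum_fourier_sq_lt_top hh)] with ξ h1 h2
  refine Summable.of_norm (tsum_enorm_ne_top_iff_summable_norm.1 (ne_of_lt ?_))
  refine lt_of_le_of_lt (ENNReal.tsum_le_tsum fun p => enorm_dualTerm_le α p ξ) ?_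
  rw [ENNReal.tsum_add]
  exact ENNReal.add_lt_top.2 ⟨h2, h1⟩

/-- The place where local integrability is decisive. The factors `φ` and `ψ` force both `ξ` and `ξ -
C_p' k` into `K`. Bounding the product of transforms by a sum of squares leaves a `g`-part at `ξ`,
with shift `-k`, and an `h`-part at `ξ - C_p' k`, with shift `k`; each is controlled by its own
condition. -/
lemma tsum_lintegral_pairTerm_lt_top {K : Set (EuclideanSpace ℝ (Fin d))} (hK : MeasurableSet K)
    (hg : ShiftIntegrableOn C g K) (hh : ShiftIntegrableOn C h K)
    {φ ψ : EuclideanSpace ℝ (Fin d) → ℂ} (hφ : IsTestOn K φ) (hψ : IsTestOn K ψ) :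
    ∑' j : P × (Fin d → ℤ), ∫⁻ ξ, ‖pairTerm C g h φ ψ (frequency C j) j.1 ξ‖ₑ < ∞ := by
  obtain ⟨M, hM⟩ := hφ.bounded
  obtain ⟨N, hN⟩ := hψ.bounded
  let G : P → (Fin d → ℤ) → EuclideanSpace ℝ (Fin d) → ℝ≥0∞ := fun p k ξ =>
    K.indicator (fun _ => (1 : ℝ≥0∞)) (ξ + latticePoint (dualMatrix (C p)) k) *
      ENNReal.ofReal (|(C p).det|⁻¹) * ‖(𝓕 (g p) : L2 d) ξ‖ₑ ^ 2
  let L : P → (Fin d → ℤ) → EuclideanSpace ℝ (Fin d) → ℝ≥0∞ := fun p k ξ =>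
    K.indicator (fun _ => (1 : ℝ≥0∞)) (ξ + latticePoint (dualMatrix (C p)) k) *
      ENNReal.ofReal (|(C p).det|⁻¹) * ‖(𝓕 (h p) : L2 d) ξ‖ₑ ^ 2
  have hpt : ∀ p k ξ, ‖pairTerm C g h φ ψ (frequency C (p, k)) p ξ‖ₑ ≤
      (ENNReal.ofReal M * ENNReal.ofReal N) * (K.indicator (G p (-k)) ξ +
        K.indicator (L p k) (ξ - frequency C (p, k))) := by
    intro p k ξ
    by_cases h1 : ξ ∈ K
    · by_cases h2 : ξ - frequency C (p, k) ∈ K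
      · rw [pairTerm, enorm_mul, enorm_mul, RCLike.enorm_conj, RCLike.enorm_conj,
          Set.indicator_of_mem h1, Set.indicator_of_mem h2]
        gcongr
        · rw [← ofReal_norm]
          exact ENNReal.ofReal_le_ofReal (hM ξ)
        · rw [← ofReal_norm]
          exact ENNReal.ofReal_le_ofReal (hN _)
        · refine (enorm_dualTerm_le _ p ξ).trans (le_of_eq ?_)
          have h3 : ξ + latticePoint (dualMatrix (C p)) (-k) ∈ K := by
            rwa [latticePoint_neg, ← sub_eq_add_neg]
          have h4 : ξ - frequency C (p, k) + latticePoint (dualMatrix (C p)) k ∈ K := by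
            rwa [frequency, sub_add_cancel]
          simp only [G, L, Set.indicator_of_mem h3, Set.indicator_of_mem h4, one_mul]
          rw [add_comm]
      · simp [pairTerm, hψ.vanish _ h2]
    · simp [pairTerm, hφ.vanish _ h1]
  have hint : ∀ p k, ∫⁻ ξ, ‖pairTerm C g h φ ψ (frequency C (p, k)) p ξ‖ₑ ≤
      (ENNReal.ofReal M * ENNReal.ofReal N) * (∫⁻ ξ in K, G p (-k) ξ) +
        (ENNReal.ofReal M * ENNReal.ofReal N) * ∫⁻ ξ in K, L p k ξ := by
    intro p k
    refine (lintegral_mono (hpt p k)).trans ?_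
    have hGm : AEMeasurable (K.indicator (G p (-k))) volume := by
      refine AEMeasurable.indicator ?_ hK
      refine AEMeasurable.mul (AEMeasurable.mul_const ?_ _)
        ((Lp.aestronglyMeasurable _).enorm.pow_const 2)
      exact ((measurable_const.indicator hK).comp (measurable_id.add_const _)).aemeasurable
    rw [lintegral_const_mul' _ _ (ENNReal.mul_ne_top ENNReal.ofReal_ne_top ENNReal.ofReal_ne_top),
      lintegral_add_left' hGm, lintegral_sub_right_eq_self (K.indicator (L p k)),
      lintegral_indicator hK, lintegral_indicator hK, mul_add]
  refine (ENNReal.tsum_prod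
    (f := fun p k => ∫⁻ ξ, ‖pairTerm C g h φ ψ (frequency C (p, k)) p ξ‖ₑ)).trans_lt ?_
  refine lt_of_le_of_lt (ENNReal.tsum_le_tsum fun p => ENNReal.tsum_le_tsum fun k => hint p k) ?_
  simp_rw [ENNReal.tsum_add, ENNReal.tsum_mul_left]
  have hneg : ∀ p, ∑' k, ∫⁻ ξ in K, G p (-k) ξ = ∑' k, ∫⁻ ξ in K, G p k ξ := fun p =>
    (Equiv.neg (Fin d → ℤ)).tsum_eq fun k => ∫⁻ ξ in K, G p k ξ
  simp_rw [hneg]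
  exact ENNReal.add_lt_top.2
    ⟨ENNReal.mul_lt_top (ENNReal.mul_lt_top ENNReal.ofReal_lt_top ENNReal.ofReal_lt_top) hg,
      ENNReal.mul_lt_top (ENNReal.mul_lt_top ENNReal.ofReal_lt_top ENNReal.ofReal_lt_top) hh⟩

lemma integrable_pairTerm {K : Set (EuclideanSpace ℝ (Fin d))} (hK : MeasurableSet K)
    (hg : ShiftIntegrableOn C g K) (hh : ShiftIntegrableOn C h K)
    {φ ψ : EuclideanSpace ℝ (Fin d) → ℂ} (hφ : IsTestOn K φ) (hψ : IsTestOn K ψ)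
    (j : P × (Fin d → ℤ)) : Integrable (pairTerm C g h φ ψ (frequency C j) j.1) volume :=
  ⟨aestronglyMeasurable_pairTerm hφ hψ _ _,
    (ENNReal.le_tsum j).trans_lt (tsum_lintegral_pairTerm_lt_top hK hg hh hφ hψ)⟩

lemma summable_integral_norm_pairTerm {K : Set (EuclideanSpace ℝ (Fin d))} (hK : MeasurableSet K)
    (hg : ShiftIntegrableOn C g K) (hh : ShiftIntegrableOn C h K)
    {φ ψ : EuclideanSpace ℝ (Fin d) → ℂ} (hφ : IsTestOn K φ) (hψ : IsTestOn K ψ) :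
    Summable fun j : P × (Fin d → ℤ) => ∫ ξ, ‖pairTerm C g h φ ψ (frequency C j) j.1 ξ‖ := by
  refine (ENNReal.summable_toReal (tsum_lintegral_pairTerm_lt_top hK hg hh hφ hψ).ne).congr
    fun j => ?_
  rw [integral_norm_eq_lintegral_enorm (aestronglyMeasurable_pairTerm hφ hψ _ _)]

lemma summable_norm_integral_pairTerm {K : Set (EuclideanSpace ℝ (Fin d))} (hK : MeasurableSet K)
    (hg : ShiftIntegrableOn C g K) (hh : ShiftIntegrableOn C h K)
    {φ ψ : EuclideanSpace ℝ (Fin d) → ℂ} (hφ : IsTestOn K φ) (hψ : IsTestOn K ψ) :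
    Summable fun j : P × (Fin d → ℤ) => ‖∫ ξ, pairTerm C g h φ ψ (frequency C j) j.1 ξ‖ :=
  (summable_integral_norm_pairTerm hK hg hh hφ hψ).of_nonneg_of_le (fun _ => norm_nonneg _)
    fun _ => norm_integral_le_integral_norm _

/-- The matrix coefficients of the mixed frame operator as a sum of cross terms. -/
lemma hasSum_integral_pairTerm (hC : ∀ p, IsUnit (C p).det)
    {K : Set (EuclideanSpace ℝ (Fin d))} (hK : IsCompact K)
    (hg : ShiftIntegrableOn C g K) (hh : ShiftIntegrableOn C h K)
    {φ ψ : EuclideanSpace ℝ (Fin d) → ℂ} (hφ : IsTestOn K φ) (hψ : IsTestOn K ψ)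
    {S : L2 d → L2 d} (hS : ∀ v, HasSum (fun j => inner ℂ (translationSystem C g j) v •
      translationSystem C h j) (S v)) {f u : L2 d} (hf : (𝓕 f : L2 d) =ᵐ[volume] φ)
    (hu : (𝓕 u : L2 d) =ᵐ[volume] ψ) :
    HasSum (fun j : P × (Fin d → ℤ) => ∫ ξ, pairTerm C g h φ ψ (frequency C j) j.1 ξ)
      (inner ℂ u (S f)) := by
  obtain ⟨R, hR⟩ := hK.isBounded.exists_norm_le
  have htest : ∀ {χ : EuclideanSpace ℝ (Fin d) → ℂ} (_ : IsTestOn K χ) (w : L2 d),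
      MemLp (fun ξ => χ ξ * starRingEnd ℂ ((𝓕 w : L2 d) ξ)) 2 volume := by
    intro χ hχ w
    exact (Lp.memLp (𝓕 w : L2 d)).star.mul (r := 2) (hχ.memLp hK ∞)
  have hvan : ∀ {χ : EuclideanSpace ℝ (Fin d) → ℂ} (_ : IsTestOn K χ) (w : L2 d) (ξ) (_ : R < ‖ξ‖),
      χ ξ * starRingEnd ℂ ((𝓕 w : L2 d) ξ) = 0 := by
    intro χ hχ w ξ hξ
    rw [hχ.vanish ξ fun hmem => (not_le.2 hξ) (hR ξ hmem), zero_mul]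
  have hcoef : ∀ {χ : EuclideanSpace ℝ (Fin d) → ℂ} {v : L2 d} (_ : (𝓕 v : L2 d) =ᵐ[volume] χ)
      (w : L2 d) (a : EuclideanSpace ℝ (Fin d)), inner ℂ (translateL2 a w) v =
        ∫ ξ, χ ξ * starRingEnd ℂ ((𝓕 w : L2 d) ξ) * planeWave a ξ := by
    intro χ v hv w a
    rw [inner_translateL2]
    refine integral_congr_ae ?_
    filter_upwards [hv] with ξ hξ
    rw [hξ]
  have hp := fun p => hasSum_parseval_lattice (hC p) (htest hφ (g p)) (htest hψ (h p))
    (hvan hφ (g p)) (hvan hψ (h p))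
  choose v hv1 hv2 using hp
  have hW : HasSum (fun j : P × (Fin d → ℤ) => inner ℂ (translationSystem C g j) f *
      inner ℂ u (translationSystem C h j)) (inner ℂ u (S f)) := by
    refine HasSum.congr_fun ((innerSL ℂ u).hasSum (hS f)) fun j => ?_
    rw [innerSL_apply_apply, inner_smul_right]
  have hX := (summable_norm_integral_pairTerm hK.measurableSet hg hh hφ hψ).of_norm.hasSum
  -- For each `p`, Parseval gives the frame series and the cross-term series the same inner sum `v
  -- p`. Both double series converge unconditionally, so their totals agree.
  have hvW : HasSum v (inner ℂ u (S f)) := by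
    refine hW.prod_fiberwise fun p => ?_
    refine HasSum.congr_fun (hv1 p) fun k => ?_
    rw [← inner_conj_symm u, translationSystem, translationSystem, hcoef hf, hcoef hu]
  have hvX := hX.prod_fiberwise (g := v) fun p => by
    refine HasSum.congr_fun (hv2 p) fun k => ?_
    rw [← integral_const_mul]
    refine integral_congr_ae (ae_of_all _ fun ξ => ?_)
    simp only [pairTerm, dualTerm, frequency, map_mul, Complex.conj_conj, Complex.conj_ofReal]
    ring
  rwa [hvX.unique hvW] at hX

end CrossTerms

/-! ### Grouping the cross terms by frequency -/

lemma integrable_tsum_of_tsum_lintegral_lt_top {X ι : Type*} [MeasurableSpace X] {μ : Measure X}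
    [Countable ι] {F : ι → X → ℂ} (hF : ∀ i, AEStronglyMeasurable (F i) μ)
    (hsum : ∑' i, ∫⁻ x, ‖F i x‖ₑ ∂μ < ∞) : Integrable (fun x => ∑' i, F i x) μ := by
  refine ⟨(AEMeasurable.tsum fun i => (hF i).aemeasurable).aestronglyMeasurable, ?_⟩
  refine lt_of_le_of_lt (lintegral_mono fun x => enorm_tsum_le_tsum_enorm) ?_
  rwa [lintegral_tsum fun i => (hF i).enorm]

section Fibers

variable {d : ℕ} {P : Type*} (C : P → Matrix (Fin d) (Fin d) ℝ) (g h : P → L2 d)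

/-- The sum of the series in the duality condition at frequency `α`. -/
noncomputable def dualSum (α ξ : EuclideanSpace ℝ (Fin d)) : ℂ :=
  ∑' p : indexSet C α, dualTerm C g h α p ξ

variable {C g h}

lemma latticePoint_dualMatrix_eq_iff {D : Matrix (Fin d) (Fin d) ℝ} (hD : IsUnit D.det)
    (k : Fin d → ℤ) (α : EuclideanSpace ℝ (Fin d)) :
    latticePoint (dualMatrix D) k = α ↔ Dᵀ *ᵥ α.ofLp = fun i => (k i : ℝ) := by
  have hT : IsUnit Dᵀ.det := by rwa [Matrix.det_transpose]
  constructor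
  · rintro rfl
    rw [latticePoint, dualMatrix, Matrix.mulVec_mulVec, Matrix.mul_nonsing_inv _ hT,
      Matrix.one_mulVec]
  · intro h1
    rw [latticePoint, dualMatrix, ← h1, Matrix.mulVec_mulVec, Matrix.nonsing_inv_mul _ hT,
      Matrix.one_mulVec]

lemma mem_indexSet_zero (p : P) : p ∈ indexSet C 0 :=
  ⟨0, by
    funext i
    simp⟩

/-- The index of a cross term with frequency `α` is determined by an element of `indexSet C α`. -/
lemma exists_injective_frequency (hC : ∀ p, IsUnit (C p).det) (α : EuclideanSpace ℝ (Fin d)) :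
    ∃ i : indexSet C α → P × (Fin d → ℤ), Function.Injective i ∧
      (∀ p, (i p).1 = p ∧ frequency C (i p) = α) ∧ ∀ j, frequency C j = α → j ∈ Set.range i := by
  choose k hk using fun p : indexSet C α => p.2
  refine ⟨fun p => (p, k p), fun p q hpq => Subtype.ext (Prod.ext_iff.1 hpq).1,
    fun p => ⟨rfl, (latticePoint_dualMatrix_eq_iff (hC p) _ _).2 (hk p)⟩, fun j hj => ?_⟩
  have h1 := (latticePoint_dualMatrix_eq_iff (hC j.1) _ _).1 hj
  refine ⟨⟨j.1, j.2, h1⟩, Prod.ext rfl ?_⟩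
  funext i
  have h2 := congrFun ((hk ⟨j.1, j.2, h1⟩).symm.trans h1) i
  exact_mod_cast h2

lemma mul_dualSum_eq_tsum (φ ψ : EuclideanSpace ℝ (Fin d) → ℂ) (α : EuclideanSpace ℝ (Fin d)) :
    (fun ξ => φ ξ * starRingEnd ℂ (ψ (ξ - α)) * starRingEnd ℂ (dualSum C g h α ξ)) =
      fun ξ => ∑' p : indexSet C α, pairTerm C g h φ ψ α p ξ := by
  funext ξ
  simp_rw [pairTerm, tsum_mul_left, dualSum, Complex.conj_tsum]

variable [Countable P]

lemma integrable_mul_dualSum (hC : ∀ p, IsUnit (C p).det)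
    {K : Set (EuclideanSpace ℝ (Fin d))}
    (hK : MeasurableSet K) (hg : ShiftIntegrableOn C g K) (hh : ShiftIntegrableOn C h K)
    {φ ψ : EuclideanSpace ℝ (Fin d) → ℂ} (hφ : IsTestOn K φ) (hψ : IsTestOn K ψ)
    (α : EuclideanSpace ℝ (Fin d)) :
    Integrable (fun ξ => φ ξ * starRingEnd ℂ (ψ (ξ - α)) * starRingEnd ℂ (dualSum C g h α ξ))
      volume := by
  obtain ⟨i, hi, hiα, -⟩ := exists_injective_frequency hC α
  rw [mul_dualSum_eq_tsum]
  refine integrable_tsum_of_tsum_lintegral_lt_top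
    (F := fun (p : indexSet C α) ξ => pairTerm C g h φ ψ α p ξ)
    (fun p => aestronglyMeasurable_pairTerm hφ hψ α p.1) ?_
  have hle := ENNReal.tsum_comp_le_tsum_of_injective hi
    fun j => ∫⁻ ξ, ‖pairTerm C g h φ ψ (frequency C j) j.1 ξ‖ₑ
  simp only [hiα] at hle
  exact hle.trans_lt (tsum_lintegral_pairTerm_lt_top hK hg hh hφ hψ)

/-- The terms of frequency `α` correspond to the elements of `indexSet C α`, since `p` and `α`
determine `k`; absolute convergence lets their sum pass under the integral. -/
lemma tsum_frequency_eq_integral_dualSum (hC : ∀ p, IsUnit (C p).det)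
    {K : Set (EuclideanSpace ℝ (Fin d))}
    (hK : MeasurableSet K) (hg : ShiftIntegrableOn C g K) (hh : ShiftIntegrableOn C h K)
    {φ ψ : EuclideanSpace ℝ (Fin d) → ℂ} (hφ : IsTestOn K φ) (hψ : IsTestOn K ψ)
    (α : EuclideanSpace ℝ (Fin d)) :
    ∑' j, (if frequency C j - α = 0 then ∫ ξ, pairTerm C g h φ ψ (frequency C j) j.1 ξ else 0) =
      ∫ ξ, φ ξ * starRingEnd ℂ (ψ (ξ - α)) * starRingEnd ℂ (dualSum C g h α ξ) := by
  obtain ⟨i, hi, hiα, hrange⟩ := exists_injective_frequency hC α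
  have hterm : ∀ p : indexSet C α, pairTerm C g h φ ψ (frequency C (i p)) (i p).1 =
      pairTerm C g h φ ψ α p := fun p => by rw [(hiα p).1, (hiα p).2]
  rw [mul_dualSum_eq_tsum, ← integral_tsum_of_summable_integral_norm]
  · refine (hi.tsum_eq fun j hj => hrange j (sub_eq_zero.1 ?_)).symm.trans
      (tsum_congr fun p => ?_)
    · by_contra hne
      exact hj (if_neg hne)
    · rw [if_pos (sub_eq_zero.2 (hiα p).2), hterm]
  · intro p
    rw [← hterm]
    exact integrable_pairTerm hK hg hh hφ hψ _
  · refine ((summable_integral_norm_pairTerm hK hg hh hφ hψ).comp_injective hi).congr fun p => ?_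
    rw [Function.comp, hterm]

end Fibers

/-! ### Approximation by test functions -/

lemma exists_fourier_eq {d : ℕ} {φ : EuclideanSpace ℝ (Fin d) → ℂ} (hφ : MemLp φ 2 volume) :
    ∃ f : L2 d, (𝓕 f : L2 d) =ᵐ[volume] φ := by
  refine ⟨𝓕⁻ hφ.toLp, ?_⟩
  rw [FourierTransform.fourier_fourierInv_eq]
  exact hφ.coeFn_toLp

lemma inner_eq_integral_fourier {d : ℕ} {f u : L2 d} {φ ψ : EuclideanSpace ℝ (Fin d) → ℂ}
    (hf : (𝓕 f : L2 d) =ᵐ[volume] φ) (hu : (𝓕 u : L2 d) =ᵐ[volume] ψ) :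
    inner ℂ u f = ∫ ξ, φ ξ * starRingEnd ℂ (ψ ξ) := by
  rw [← Lp.inner_fourier_eq, L2.inner_def]
  refine integral_congr_ae ?_
  filter_upwards [hf, hu] with ξ h1 h2
  rw [h1, h2, RCLike.inner_apply]

lemma IsTestOn.mono {d : ℕ} {K L : Set (EuclideanSpace ℝ (Fin d))}
    {φ : EuclideanSpace ℝ (Fin d) → ℂ} (hφ : IsTestOn K φ) (hKL : K ⊆ L) : IsTestOn L φ :=
  ⟨hφ.measurable, hφ.bounded, fun ξ hξ => hφ.vanish ξ fun h => hξ (hKL h)⟩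

lemma shell_subset_shell {d m n : ℕ} (hmn : m ≤ n) : shell d m ⊆ shell d n := by
  have h : (m : ℝ) ≤ n := by exact_mod_cast hmn
  rintro ξ ⟨h1, h2⟩
  refine ⟨by linarith, h2.imp_right fun h3 => le_trans ?_ h3⟩
  gcongr

/-- Every `f ∈ L²` is a weak limit of functions with Fourier transforms that are truncations
of `𝓕 f`. -/
lemma exists_test_approximation {d : ℕ} (f : L2 d) :
    ∃ (F : ℕ → L2 d) (φ : ℕ → EuclideanSpace ℝ (Fin d) → ℂ),
      (∀ n, IsTestOn (shell d n) (φ n)) ∧ (∀ n, (𝓕 (F n) : L2 d) =ᵐ[volume] φ n) ∧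
      (∀ n ξ, (𝓕 f : L2 d) ξ = 0 → φ n ξ = 0) ∧
      ∀ w, Filter.Tendsto (fun n => inner ℂ w (F n)) Filter.atTop (𝓝 (inner ℂ w f)) := by
  classical
  have hm : Measurable (𝓕 f : L2 d) := (Lp.stronglyMeasurable (𝓕 f : L2 d)).measurable
  -- The truncation is in space and in height, which gives compact support and boundedness; a
  -- truncation also keeps the transform zero wherever it was zero, so membership in `V_E` is
  -- preserved.
  let s : ℕ → Set (EuclideanSpace ℝ (Fin d)) := fun n =>
    shell d n ∩ {ξ | ‖(𝓕 f : L2 d) ξ‖ ≤ n}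
  have hs : ∀ n, MeasurableSet (s n) := fun n =>
    (measurableSet_shell d n).inter (measurableSet_le hm.norm measurable_const)
  have htest : ∀ n, IsTestOn (shell d n) ((s n).indicator (𝓕 f : L2 d)) := by
    refine fun n => ⟨hm.indicator (hs n), ⟨n, fun ξ => ?_⟩, fun ξ hξ => ?_⟩
    · by_cases h : ξ ∈ s n
      · rw [Set.indicator_of_mem h]
        exact h.2
      · simp [Set.indicator_of_notMem h]
    · exact Set.indicator_of_notMem (fun h => hξ h.1) _
  choose F hF using fun n => exists_fourier_eq ((htest n).memLp (isCompact_shell d n) 2)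
  refine ⟨F, fun n => (s n).indicator (𝓕 f : L2 d), htest, hF, fun n ξ h => ?_, fun w => ?_⟩
  · simp [Set.indicator_apply, h]
  · simp_rw [fun n => inner_eq_integral_fourier (hF n) (Filter.EventuallyEq.refl _ (𝓕 w : L2 d))]
    rw [inner_eq_integral_fourier (Filter.EventuallyEq.refl _ (𝓕 f : L2 d))
      (Filter.EventuallyEq.refl _ (𝓕 w : L2 d))]
    have hint : Integrable (fun ξ => (𝓕 f : L2 d) ξ * starRingEnd ℂ ((𝓕 w : L2 d) ξ)) volume :=
      (Lp.memLp (𝓕 f : L2 d)).integrable_mul (Lp.memLp (𝓕 w : L2 d)).star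
    refine tendsto_integral_of_dominated_convergence
      (fun ξ => ‖(𝓕 f : L2 d) ξ * starRingEnd ℂ ((𝓕 w : L2 d) ξ)‖) (fun n => ?_) hint.norm
      (fun n => ae_of_all _ fun ξ => ?_) ?_
    · exact (htest n).measurable.aestronglyMeasurable.mul
        (RCLike.continuous_conj.comp_aestronglyMeasurable (Lp.aestronglyMeasurable _))
    · rw [norm_mul, norm_mul]
      gcongr
      exact norm_indicator_le_norm_self _ _
    · filter_upwards [ae_mem_shell d] with ξ ⟨N, hN⟩
      refine tendsto_const_nhds.congr' ?_
      obtain ⟨M, hM⟩ := exists_nat_ge ‖(𝓕 f : L2 d) ξ‖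
      filter_upwards [Filter.eventually_ge_atTop N, Filter.eventually_ge_atTop M] with n h1 h2
      have h3 : (M : ℝ) ≤ n := by exact_mod_cast h2
      rw [Set.indicator_of_mem (show ξ ∈ s n from ⟨hN n h1, hM.trans h3⟩)]

/-! ### Characterization of duality -/

section Characterization

variable {d : ℕ} {P : Type*} [Countable P] {C : P → Matrix (Fin d) (Fin d) ℝ} {g h : P → L2 d}
  {E : Set (EuclideanSpace ℝ (Fin d))} {S : L2 d →L[ℂ] L2 d}

/-- Once the cross terms are grouped by frequency, the hypothesis on `dualSum` annihilates every
group but `α = 0`, which is the inner product by Plancherel. -/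
lemma inner_mixedFrameOperator_of_dualSum (hC : ∀ p, IsUnit (C p).det)
    (hS : ∀ v, HasSum (fun j => inner ℂ (translationSystem C g j) v •
      translationSystem C h j) (S v))
    (hdual : ∀ α, ∀ᵐ ξ, ξ ∈ E → dualSum C g h α ξ = if α = 0 then 1 else 0)
    {K : Set (EuclideanSpace ℝ (Fin d))} (hK : IsCompact K)
    (hg : ShiftIntegrableOn C g K) (hh : ShiftIntegrableOn C h K)
    {φ ψ : EuclideanSpace ℝ (Fin d) → ℂ} (hφ : IsTestOn K φ) (hψ : IsTestOn K ψ)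
    (hφE : ∀ᵐ ξ, ξ ∉ E → φ ξ = 0) {f u : L2 d} (hf : (𝓕 f : L2 d) =ᵐ[volume] φ)
    (hu : (𝓕 u : L2 d) =ᵐ[volume] ψ) : inner ℂ u (S f) = inner ℂ u f := by
  classical
  have h1 := hasSum_integral_pairTerm hC hK hg hh hφ hψ hS hf hu
  have h2 := h1.tsum_fiberwise (frequency C)
  have h3 : ∀ α, ∑' j : frequency C ⁻¹' {α},
      ∫ ξ, pairTerm C g h φ ψ (frequency C j) (j : P × (Fin d → ℤ)).1 ξ = if α = 0 then inner ℂ u f else 0 := by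
    intro α
    rw [tsum_subtype (frequency C ⁻¹' {α})
      fun j => ∫ ξ, pairTerm C g h φ ψ (frequency C j) j.1 ξ]
    have h4 := tsum_frequency_eq_integral_dualSum hC hK.measurableSet hg hh hφ hψ α
    simp only [sub_eq_zero] at h4
    simp only [Set.indicator_apply, Set.mem_preimage, Set.mem_singleton_iff]
    rw [h4, inner_eq_integral_fourier hf hu]
    split_ifs with hα
    · subst hα
      refine integral_congr_ae ?_
      filter_upwards [hφE, hdual 0] with ξ h5 h6
      by_cases hξ : ξ ∈ E
      · simp [h6 hξ]
      · simp [h5 hξ]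
    · refine integral_eq_zero_of_ae ?_
      filter_upwards [hφE, hdual α] with ξ h5 h6
      by_cases hξ : ξ ∈ E
      · simp [h6 hξ, hα]
      · simp [h5 hξ]
  simp_rw [h3] at h2
  exact h2.unique (hasSum_ite_eq 0 _)

lemma mixedFrameOperator_eq_self_of_dualSum (hC : ∀ p, IsUnit (C p).det)
    (hg : ∀ n, ShiftIntegrableOn C g (shell d n)) (hh : ∀ n, ShiftIntegrableOn C h (shell d n))
    (hS : ∀ v, HasSum (fun j => inner ℂ (translationSystem C g j) v •
      translationSystem C h j) (S v))
    (hdual : ∀ α, ∀ᵐ ξ, ξ ∈ E → dualSum C g h α ξ = if α = 0 then 1 else 0)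
    {f : L2 d} (hf : f ∈ bandSpace E) : S f = f := by
  refine ext_inner_left ℂ fun u => ?_
  obtain ⟨F, φ, hφ, hF, hφf, hFf⟩ := exists_test_approximation f
  obtain ⟨U, ψ, hψ, hU, -, hUu⟩ := exists_test_approximation u
  have hφE : ∀ n, ∀ᵐ ξ, ξ ∉ E → φ n ξ = 0 := fun n => by
    filter_upwards [show ∀ᵐ ξ, ξ ∉ E → (𝓕 f : L2 d) ξ = 0 from hf] with ξ h1 h2
    exact hφf n ξ (h1 h2)
  have hn : ∀ n, inner ℂ u (S (F n)) = inner ℂ u (F n) := by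
    intro n
    have hlim : ∀ v, Filter.Tendsto (fun m => inner ℂ (U m) v) Filter.atTop (𝓝 (inner ℂ u v)) := by
      intro v
      simp_rw [← inner_conj_symm _ v]
      exact (RCLike.continuous_conj.tendsto _).comp (hUu v)
    refine tendsto_nhds_unique (hlim _) ((hlim (F n)).congr' ?_)
    -- Both test functions must live on one shell; for `m ≥ n` the shell of index `m` serves.
    filter_upwards [Filter.eventually_ge_atTop n] with m hm
    exact (inner_mixedFrameOperator_of_dualSum hC hS hdual (isCompact_shell d m) (hg m) (hh m)
      ((hφ n).mono (shell_subset_shell hm)) (hψ m) (hφE n) (hF n) (hU m)).symm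
  refine tendsto_nhds_unique ?_ ((hFf u).congr fun n => (hn n).symm)
  -- The approximation is only weak, so `S` is moved to the other side as its adjoint.
  simp_rw [← ContinuousLinearMap.adjoint_inner_left]
  exact hFf _

lemma isTestOn_indicator_one {K A : Set (EuclideanSpace ℝ (Fin d))} (hA : MeasurableSet A)
    (hAK : A ⊆ K) : IsTestOn K (A.indicator fun _ => (1 : ℂ)) := by
  refine ⟨measurable_const.indicator hA, ⟨1, fun ξ => ?_⟩,
    fun ξ hξ => Set.indicator_of_notMem (fun h => hξ (hAK h)) _⟩
  refine (norm_indicator_le_norm_self _ _).trans ?_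
  simp

lemma IsTestOn.planeWave_mul {K : Set (EuclideanSpace ℝ (Fin d))}
    {φ : EuclideanSpace ℝ (Fin d) → ℂ} (hφ : IsTestOn K φ) (a : EuclideanSpace ℝ (Fin d)) :
    IsTestOn K fun ξ => planeWave a ξ * φ ξ := by
  obtain ⟨M, hM⟩ := hφ.bounded
  refine ⟨(continuous_planeWave a).measurable.mul hφ.measurable, ⟨M, fun ξ => ?_⟩, fun ξ hξ => ?_⟩
  · rw [norm_mul, norm_planeWave, one_mul]
    exact hM ξ
  · rw [hφ.vanish ξ hξ, mul_zero]

/-- Modulating `φ` and `ψ` by the same character leaves `⟨f, u⟩` and the condition on `E` unchanged,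
but multiplies each cross term by the character's value at its frequency. The series is therefore
constant in `a`, and `tsum_frequency_eq` isolates the frequency `α`. -/
lemma integral_mul_dualSum_of_eq_self (hC : ∀ p, IsUnit (C p).det)
    (hS : ∀ v, HasSum (fun j => inner ℂ (translationSystem C g j) v •
      translationSystem C h j) (S v))
    (hSE : ∀ f ∈ bandSpace E, S f = f)
    {K : Set (EuclideanSpace ℝ (Fin d))} (hK : IsCompact K)
    (hg : ShiftIntegrableOn C g K) (hh : ShiftIntegrableOn C h K)
    {φ ψ : EuclideanSpace ℝ (Fin d) → ℂ} (hφ : IsTestOn K φ) (hψ : IsTestOn K ψ)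
    (hφE : ∀ ξ, ξ ∉ E → φ ξ = 0) (α : EuclideanSpace ℝ (Fin d)) :
    ∫ ξ, φ ξ * starRingEnd ℂ (ψ (ξ - α)) * starRingEnd ℂ (dualSum C g h α ξ) =
      if α = 0 then ∫ ξ, φ ξ * starRingEnd ℂ (ψ ξ) else 0 := by
  rw [← tsum_frequency_eq_integral_dualSum hC hK.measurableSet hg hh hφ hψ α]
  simp_rw [← neg_eq_zero (a := α)]
  refine tsum_frequency_eq _ (summable_norm_integral_pairTerm hK.measurableSet hg hh hφ hψ)
    (fun a => ?_) α
  obtain ⟨f, hf⟩ := exists_fourier_eq ((hφ.planeWave_mul a).memLp hK 2)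
  obtain ⟨u, hu⟩ := exists_fourier_eq ((hψ.planeWave_mul a).memLp hK 2)
  have h1 := hasSum_integral_pairTerm hC hK hg hh (hφ.planeWave_mul a) (hψ.planeWave_mul a) hS hf hu
  have hfE : f ∈ bandSpace E := by
    change ∀ᵐ ξ, ξ ∉ E → (𝓕 f : L2 d) ξ = 0
    filter_upwards [hf] with ξ h2 h3
    rw [h2, hφE ξ h3, mul_zero]
  have hone : ∀ ξ, planeWave a ξ * starRingEnd ℂ (planeWave a ξ) = 1 := fun ξ => by
    rw [Complex.mul_conj, Complex.normSq_eq_norm_sq, norm_planeWave]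
    simp
  rw [hSE f hfE, inner_eq_integral_fourier hf hu] at h1
  have h2 : ∀ ξ, planeWave a ξ * φ ξ * starRingEnd ℂ (planeWave a ξ * ψ ξ) =
      φ ξ * starRingEnd ℂ (ψ ξ) := fun ξ => by
    rw [map_mul]
    linear_combination (φ ξ * starRingEnd ℂ (ψ ξ)) * hone ξ
  simp_rw [h2] at h1
  refine HasSum.congr_fun h1 fun j => ?_
  rw [← integral_const_mul]
  refine integral_congr_ae (ae_of_all _ fun ξ => ?_)
  have h3 : planeWave a ξ * starRingEnd ℂ (planeWave a (ξ - frequency C j)) =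
      planeWave a (frequency C j) := by
    rw [conj_planeWave, ← planeWave_add_right]
    congr 1
    abel
  simp only [pairTerm, map_mul]
  linear_combination (-(φ ξ * starRingEnd ℂ (ψ (ξ - frequency C j)) *
    starRingEnd ℂ (dualTerm C g h (frequency C j) j.1 ξ))) * h3

/-- With `φ` the indicator of a measurable part of `E` and `ψ` that of a shell, the preceding
identity prescribes the integral of `conj D_α` over every such part, hence its values almost
everywhere. -/
lemma dualSum_eq_of_mixedFrameOperator_eq_self (hC : ∀ p, IsUnit (C p).det)
    (hg : ∀ n, ShiftIntegrableOn C g (shell d n)) (hh : ∀ n, ShiftIntegrableOn C h (shell d n))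
    (hS : ∀ v, HasSum (fun j => inner ℂ (translationSystem C g j) v •
      translationSystem C h j) (S v))
    (hE : MeasurableSet E) (hSE : ∀ f ∈ bandSpace E, S f = f) (α : EuclideanSpace ℝ (Fin d)) :
    ∀ᵐ ξ, ξ ∈ E → dualSum C g h α ξ = if α = 0 then 1 else 0 := by
  classical
  set c : ℂ := if α = 0 then 1 else 0 with hc
  -- On `B n` both `ξ` and `ξ - α` lie in the shell, so the factor `ψ (ξ - α)` is `1` there.
  let B : ℕ → Set (EuclideanSpace ℝ (Fin d)) := fun n =>
    E ∩ (shell d n ∩ (fun ξ => ξ - α) ⁻¹' shell d n)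
  have hB : ∀ n, MeasurableSet (B n) := fun n => hE.inter ((measurableSet_shell d n).inter
    ((measurable_id.sub_const α) (measurableSet_shell d n)))
  have hψ : ∀ n, IsTestOn (shell d n) ((shell d n).indicator fun _ => (1 : ℂ)) := fun n =>
    isTestOn_indicator_one (measurableSet_shell d n) subset_rfl
  have hind : ∀ n (A : Set (EuclideanSpace ℝ (Fin d))), A ⊆ B n →
      (fun ξ => A.indicator (fun _ => (1 : ℂ)) ξ *
        starRingEnd ℂ ((shell d n).indicator (fun _ => (1 : ℂ)) (ξ - α)) *
          starRingEnd ℂ (dualSum C g h α ξ)) =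
      A.indicator fun ξ => starRingEnd ℂ (dualSum C g h α ξ) := by
    intro n A hA
    funext ξ
    by_cases hξ : ξ ∈ A
    · have h1 : ξ - α ∈ shell d n := (hA hξ).2.2
      simp [Set.indicator_of_mem hξ, Set.indicator_of_mem h1]
    · simp [Set.indicator_of_notMem hξ]
  have hn : ∀ n, ∀ᵐ ξ, ξ ∈ B n → starRingEnd ℂ (dualSum C g h α ξ) - c = 0 := by
    intro n
    rw [← ae_restrict_iff' (hB n)]
    have hfin : volume (B n) < ∞ :=
      (measure_mono fun ξ hξ => hξ.2.1).trans_lt (isCompact_shell d n).measure_lt_top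
    have hint : IntegrableOn (fun ξ => starRingEnd ℂ (dualSum C g h α ξ)) (B n) volume := by
      rw [← integrable_indicator_iff (hB n), ← hind n (B n) subset_rfl]
      exact integrable_mul_dualSum hC (measurableSet_shell d n) (hg n) (hh n)
        (isTestOn_indicator_one (hB n) fun ξ hξ => hξ.2.1) (hψ n) α
    have hconst : IntegrableOn (fun _ => c) (B n) volume := integrableOn_const hfin.ne
    refine Integrable.ae_eq_zero_of_forall_setIntegral_eq_zero (hint.sub hconst) fun s hs _ => ?_
    rw [Measure.restrict_restrict hs]
    have hA : MeasurableSet (s ∩ B n) := hs.inter (hB n)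
    have hAB : s ∩ B n ⊆ B n := Set.inter_subset_right
    have key := integral_mul_dualSum_of_eq_self hC hS hSE (isCompact_shell d n) (hg n) (hh n)
      (isTestOn_indicator_one hA fun ξ hξ => (hAB hξ).2.1) (hψ n)
      (fun ξ hξ => Set.indicator_of_notMem (fun h => hξ (hAB h).1) _) α
    rw [hind n _ hAB, integral_indicator hA] at key
    have hw : ∫ ξ, (s ∩ B n).indicator (fun _ => (1 : ℂ)) ξ *
        starRingEnd ℂ ((shell d n).indicator (fun _ => (1 : ℂ)) ξ) = ∫ ξ in s ∩ B n, 1 := by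
      rw [← integral_indicator hA]
      refine integral_congr_ae (ae_of_all _ fun ξ => ?_)
      by_cases hξ : ξ ∈ s ∩ B n
      · have h1 : ξ ∈ shell d n := (hAB hξ).2.1
        simp only [Set.indicator_of_mem hξ, Set.indicator_of_mem h1, map_one, mul_one]
      · simp only [Set.indicator_of_notMem hξ, zero_mul]
    refine (integral_sub (hint.mono_set hAB) (hconst.mono_set hAB)).trans ?_
    rw [key, hw, hc]
    split_ifs <;> simp
  filter_upwards [ae_all_iff.2 hn, ae_mem_shell d,
    (measurePreserving_sub_right volume α).quasiMeasurePreserving.ae (ae_mem_shell d)]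
    with ξ h1 ⟨N, hN⟩ ⟨M, hM⟩ hξ
  have h2 := h1 (max N M) ⟨hξ, hN _ (le_max_left _ _), hM _ (le_max_right _ _)⟩
  have h3 := congrArg (starRingEnd ℂ) (sub_eq_zero.1 h2)
  rw [Complex.conj_conj] at h3
  rw [h3, hc]
  split_ifs <;> simp

/-- At `α = 0` the index set is all of `P`, which gives the first condition; for `α` outside `Λ` it
is empty, so that frequency imposes nothing. -/
lemma ae_dualSum_eq_iff (hC : ∀ p, IsUnit (C p).det)
    (hg : ∀ n, ShiftIntegrableOn C g (shell d n)) (hh : ∀ n, ShiftIntegrableOn C h (shell d n)) :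
    (∀ α, ∀ᵐ ξ, ξ ∈ E → dualSum C g h α ξ = if α = 0 then 1 else 0) ↔
      (∀ᵐ ξ, ξ ∈ E → HasSum (fun p : P => ((|(C p).det|⁻¹ : ℝ) : ℂ) *
        starRingEnd ℂ ((𝓕 (h p) : L2 d) ξ) * (𝓕 (g p) : L2 d) ξ) 1) ∧
      ∀ α ∈ dualLatticeUnion C \ {0}, ∀ᵐ ξ, ξ ∈ E →
        HasSum (fun p : indexSet C α => ((|(C p).det|⁻¹ : ℝ) : ℂ) *
          starRingEnd ℂ ((𝓕 (h p) : L2 d) (ξ - α)) * (𝓕 (g p) : L2 d) ξ) 0 := by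
  have hiff : ∀ α c, (∀ᵐ ξ, ξ ∈ E → dualSum C g h α ξ = c) ↔
      ∀ᵐ ξ, ξ ∈ E → HasSum (fun p : indexSet C α => dualTerm C g h α p ξ) c := by
    intro α c
    refine Filter.eventually_congr ?_
    filter_upwards [ae_summable_dualTerm hg hh α] with ξ hξ
    exact imp_congr_right fun _ => (hξ.subtype (indexSet C α)).hasSum_iff.symm
  have hzero : ∀ ξ, HasSum (fun p : indexSet C 0 => dualTerm C g h 0 p ξ) 1 ↔
      HasSum (fun p : P => ((|(C p).det|⁻¹ : ℝ) : ℂ) *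
        starRingEnd ℂ ((𝓕 (h p) : L2 d) ξ) * (𝓕 (g p) : L2 d) ξ) 1 := by
    intro ξ
    rw [← hasSum_subtype_iff_of_support_subset (s := indexSet C 0)
      fun p _ => mem_indexSet_zero p]
    simp only [dualTerm, sub_zero]
    rfl
  constructor
  · intro hdual
    refine ⟨?_, fun α hα => ?_⟩
    · simpa only [hzero] using (hiff 0 1).1 (by simpa using hdual 0)
    · exact (hiff α 0).1 (by simpa [show α ≠ 0 from hα.2] using hdual α)
  · rintro ⟨h1, h2⟩ α
    rw [hiff]
    split_ifs with hα
    · subst hα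
      simpa only [hzero] using h1
    · by_cases hΛ : α ∈ dualLatticeUnion C
      · exact h2 α ⟨hΛ, hα⟩
      · have hempty : IsEmpty (indexSet C α) := by
          refine ⟨fun p => hΛ ?_⟩
          obtain ⟨k, hk⟩ := p.2
          exact Set.mem_iUnion.2 ⟨p, k, (latticePoint_dualMatrix_eq_iff (hC p) k α).2 hk⟩
        exact ae_of_all _ fun ξ _ => hasSum_empty

end Characterization

end TranslationFrames

theorem mainTheorem11 {d : ℕ} {P : Type*} [Countable P]
    (C : P → Matrix (Fin d) (Fin d) ℝ) (hC : ∀ p, IsUnit (C p).det)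
    (g h : P → TranslationFrames.L2 d)
    (hgB : TranslationFrames.IsBessel (TranslationFrames.translationSystem C g))
    (hhB : TranslationFrames.IsBessel (TranslationFrames.translationSystem C h))
    (hgL : TranslationFrames.LocallyIntegrableSystem C g)
    (hhL : TranslationFrames.LocallyIntegrableSystem C h)
    (E : Set (EuclideanSpace ℝ (Fin d))) (hE : MeasurableSet E) :
    TranslationFrames.IsSubspaceDual (TranslationFrames.bandSpace E)
        (TranslationFrames.translationSystem C g) (TranslationFrames.translationSystem C h) ↔
      (∀ᵐ ξ, ξ ∈ E →
        HasSum (fun p : P => ((|(C p).det|⁻¹ : ℝ) : ℂ) *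
          starRingEnd ℂ ((𝓕 (h p) : TranslationFrames.L2 d) ξ) *
            (𝓕 (g p) : TranslationFrames.L2 d) ξ) 1) ∧
      ∀ α ∈ TranslationFrames.dualLatticeUnion C \ {0}, ∀ᵐ ξ, ξ ∈ E →
        HasSum (fun p : TranslationFrames.indexSet C α => ((|(C p).det|⁻¹ : ℝ) : ℂ) *
          starRingEnd ℂ ((𝓕 (h p) : TranslationFrames.L2 d) (ξ - α)) *
            (𝓕 (g p) : TranslationFrames.L2 d) ξ) 0 := by
  obtain ⟨S, hS⟩ := TranslationFrames.exists_mixedFrameOperator hgB hhB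
  have hg := TranslationFrames.shiftIntegrableOn_shell hgB hgL
  have hh := TranslationFrames.shiftIntegrableOn_shell hhB hhL
  rw [← TranslationFrames.ae_dualSum_eq_iff hC hg hh]
  constructor
  · rintro ⟨-, -, hdual⟩
    exact TranslationFrames.dualSum_eq_of_mixedFrameOperator_eq_self hC hg hh hS hE
      fun f hf => (hS f).unique (hdual f hf)
  · intro hdual
    refine ⟨hgB, hhB, fun f hf => ?_⟩
    have := hS f
    rwa [TranslationFrames.mixedFrameOperator_eq_self_of_dualSum hC hg hh hS hdual hf] at this
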